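/- Let $n\ge 2$, $m\ge 0$ be integers, $\kappa\in\mathbb R$, let $N^{n+m}(\kappa)$ be a Riemannian manifold of dimension $n+m$ with constant sectional curvature $\kappa$ (a real space form), and let $M^n$ be an $n$-dimensional submanifold isometrically immersed in it. For $p\in M$ and $\xi\in T_p^\perp M$ let $\mathrm{II}_\xi(X,Y)=\langle \mathrm{II}(X,Y),\xi\rangle$ be the second fundamental form in the direction $\xi$, and let $|\mathrm{II}_p|=\mathrm{span}\{\mathrm{II}_\xi:\xi\in T_p^\perp M\}\subset S^2(T_p^*M)$. The submanifold is austere if for every normal vector $\xi$ the nonzero principal curvatures in the direction $\xi$ occur in oppositely signed pairs. It is of type $\mathcal Q(n-1,1)$ if for each $p\in M$ there is an orthonormal basis of $T_pM$ in which every element of $|\mathrm{II}_p|$ has a matrix of the form $$\begin{pmatrix}0&a\\a^t&0\end{pmatrix},\qquad a\in M(n-1,1).$$ Let $$\rho=\frac{2}{n(n-1)}\sum_{i<j}\langle R(e_i,e_j)e_j,e_i\rangle,\qquad \rho^\perp=\frac{2}{n(n-1)}\Big(\sum_{i<j}\sum_{r<s}\langle R^\perp(e_i,e_j)\xi_r,\xi_s\rangle^2\Big)^{1/2}$$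 be the normalized scalar curvature of $M$ and the normalized normal scalar curvature, where $R$ is the curvature tensor of the induced metric (with the sign for which $\langle R(X,Y)Y,X\rangle$ is the sectional curvature for orthonormal $X,Y$), $R^\perp$ is the curvature tensor of the normal connection, and $(e_i)$, $(\xi_r)$ are orthonormal bases of $T_pM$ and $T_p^\perp M$. Suppose that $M^n$ is austere of type $\mathcal Q(n-1,1)$. Then for every $p\in M$, with $d=\dim|\mathrm{II}_p|$, $$\rho^{\perp}\le\sqrt{\frac{d-1}{2d}}\,(\kappa-\rho)\quad\text{at } p,$$ where the coefficient is read as $0$ if $d=0$. Equality holds at $p$ if and only if there exist an orthonormal basis $\{e_1,\dots,e_n\}$ of $T_pM$, an orthonormal basis $\{\xi_1,\dots,\xi_m\}$ of $T_p^\perp M$ and a real number $\lambda$ such that the matrices $A_r=(\mathrm{II}_{\xi_r}(e_i,e_j))_{i,j}$ are $$A_r=\lambda\,(E_{rn}+E_{nr})\ \text{ for } 1\le r\le d,\qquad A_r=0\ \text{ for } r>d,$$ where $E_{ij}$ denotes the $n\times n$ matrix with $1$ in position $(i,j)$ and $0$ elsewhere. -/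

import Mathlib

open scoped Manifold ContDiff

set_option linter.unusedSectionVars false

noncomputable section

namespace AustereSubmanifold

/-! ### Riemannian geometry in coordinates

`E` and `E'` are coordinate spaces, `g` is a metric in coordinates (a field of bilinear forms on
the coordinate space), and `F : E → E'` is a map between coordinate spaces. -/

section Coordinates

variable {E E' : Type*} [NormedAddCommGroup E] [NormedSpace ℝ E]
  [NormedAddCommGroup E'] [NormedSpace ℝ E']

/-- The Christoffel symbols (second kind) of the metric `g`, as a vector: `Γ(u, v)` is the vector
with `g(Γ(u, v), w) = ½ (∂_u g(v, w) + ∂_v g(u, w) - ∂_w g(u, v))` for all `w`. -/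
def christoffel (g : E → E →L[ℝ] E →L[ℝ] ℝ) (x : E) (u v : E) : E :=
  (g x).inverse ((1 / 2 : ℝ) •
    (fderiv ℝ g x u v + fderiv ℝ g x v u - ((fderiv ℝ g x).flip u).flip v))

/-- The Levi-Civita covariant derivative `∇_u V`, at `x`, of a vector field `V` along the map
`F : E → E'`, where `E'` carries the metric `g`: in coordinates,
`∂_u V + Γ(∂_u F, V)`. For `F = id` this is the covariant derivative of vector fields. -/
def covDerivAlong (g : E' → E' →L[ℝ] E' →L[ℝ] ℝ) (F : E → E') (V : E → E') (u : E) (x : E) : E' :=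
  fderiv ℝ V x u + christoffel g (F x) (fderiv ℝ F x u) (V x)

/-- The Riemann curvature `R(u, v) w = ∇_u ∇_v w - ∇_v ∇_u w` at `x`, where `u, v, w` are extended
to constant coordinate vector fields (so that `[u, v] = 0`). -/
def riemannCoord (g : E → E →L[ℝ] E →L[ℝ] ℝ) (x : E) (u v w : E) : E :=
  covDerivAlong g id (covDerivAlong g id (fun _ => w) v) u x -
    covDerivAlong g id (covDerivAlong g id (fun _ => w) u) v x

/-- The metric induced by `F : E → E'` on `E`. -/
def inducedMetric (g : E' → E' →L[ℝ] E' →L[ℝ] ℝ) (F : E → E') (x : E) : E →L[ℝ] E →L[ℝ] ℝ :=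
  (g (F x)).bilinearComp (fderiv ℝ F x) (fderiv ℝ F x)

/-- The `g`-orthogonal projection of `E'` onto the tangent space `range (dF_x)` of the immersion
`F` at `x`: it maps `w` to `dF_x u`, where `g(dF_x u, dF_x v) = g(w, dF_x v)` for all `v`. -/
def tangentProj (g : E' → E' →L[ℝ] E' →L[ℝ] ℝ) (F : E → E') (x : E) (w : E') : E' :=
  fderiv ℝ F x ((inducedMetric g F x).inverse ((g (F x) w).comp (fderiv ℝ F x)))

/-- The `g`-orthogonal projection of `E'` onto the normal space of the immersion `F` at `x`. -/
def normalProj (g : E' → E' →L[ℝ] E' →L[ℝ] ℝ) (F : E → E') (x : E) (w : E') : E' :=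
  w - tangentProj g F x w

/-- The second fundamental form `II(u, v) = (∇_u dF(v))^⊥` of the immersion `F`, at `x`. -/
def secondFundCoord (g : E' → E' →L[ℝ] E' →L[ℝ] ℝ) (F : E → E') (x : E) (u v : E) : E' :=
  normalProj g F x (covDerivAlong g F (fun y => fderiv ℝ F y v) u x)

/-- The normal connection `∇^⊥_u V = (∇_u V)^⊥`, for a normal field `V` along the
immersion `F`. -/
def normalCovDeriv (g : E' → E' →L[ℝ] E' →L[ℝ] ℝ) (F : E → E') (V : E → E') (u : E) (x : E) : E' :=
  normalProj g F x (covDerivAlong g F V u x)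

/-- The curvature of the normal connection, `R^⊥(u, v) ξ = ∇^⊥_u ∇^⊥_v ξ - ∇^⊥_v ∇^⊥_u ξ` at `x`,
where `u, v` are extended to constant coordinate fields, and the normal vector `ξ` at `x` is
extended to the normal field `y ↦ (ξ)^⊥` along `F`. -/
def normalCurvCoord (g : E' → E' →L[ℝ] E' →L[ℝ] ℝ) (F : E → E') (x : E) (u v : E) (ξ : E') : E' :=
  normalCovDeriv g F (normalCovDeriv g F (fun y => normalProj g F y ξ) v) u x -
    normalCovDeriv g F (normalCovDeriv g F (fun y => normalProj g F y ξ) u) v x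

end Coordinates

/-! ### Orthonormal bases -/

/-- The vectors `e i` are orthonormal for the bilinear form `B`. -/
def IsOrthonormalFor {V ι : Type*} (B : V → V → ℝ) (e : ι → V) : Prop :=
  (∀ i, B (e i) (e i) = 1) ∧ ∀ i j, i ≠ j → B (e i) (e j) = 0

theorem exists_orthonormal_basis {V : Type*} [AddCommGroup V] [Module ℝ V]
    [FiniteDimensional ℝ V] (B : LinearMap.BilinForm ℝ V) (hs : ∀ v w, B v w = B w v)
    (hp : ∀ v, v ≠ 0 → 0 < B v v) :
    ∃ e : Module.Basis (Fin (Module.finrank ℝ V)) ℝ V, IsOrthonormalFor (fun v w => B v w) e := by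
  obtain ⟨b, hb⟩ := LinearMap.BilinForm.exists_orthogonal_basis (B := B)
    ⟨hs⟩
  have hpos : ∀ i, 0 < B (b i) (b i) := fun i => hp _ (b.ne_zero i)
  have hne : ∀ i, (Real.sqrt (B (b i) (b i)))⁻¹ ≠ 0 := fun i =>
    inv_ne_zero (Real.sqrt_ne_zero'.2 (hpos i))
  refine ⟨b.isUnitSMul (fun i => isUnit_iff_ne_zero.2 (hne i)), fun i => ?_, fun i j hij => ?_⟩
  · simp only [Module.Basis.isUnitSMul_apply, map_smul, LinearMap.smul_apply, smul_eq_mul]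
    rw [← mul_assoc, ← mul_inv, Real.mul_self_sqrt (hpos i).le, inv_mul_cancel₀ (hpos i).ne']
  · have : B (b i) (b j) = 0 := hb hij
    simp [Module.Basis.isUnitSMul_apply, this]

/-! ### Riemannian manifolds -/

/-- A smooth Riemannian metric on a manifold of dimension `k`. -/
abbrev SmoothMetric (k : ℕ) (M : Type*) [TopologicalSpace M]
    [ChartedSpace (EuclideanSpace ℝ (Fin k)) M] [IsManifold (𝓡 k) ∞ M] :=
  Bundle.ContMDiffRiemannianMetric (𝓡 k) ∞ (EuclideanSpace ℝ (Fin k))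
    (fun x : M => TangentSpace (𝓡 k) x)

section Manifold

variable {k : ℕ} {M : Type*} [TopologicalSpace M] [ChartedSpace (EuclideanSpace ℝ (Fin k)) M]
  [IsManifold (𝓡 k) ∞ M]

/-- The coordinates of a tangent vector at `p`, in the preferred chart at `p`. -/
def coord (p : M) : TangentSpace (𝓡 k) p →L[ℝ] EuclideanSpace ℝ (Fin k) :=
  (NormedSpace.fromTangentSpace (𝕜 := ℝ) (extChartAt (𝓡 k) p p) :
      TangentSpace 𝓘(ℝ, EuclideanSpace ℝ (Fin k)) (extChartAt (𝓡 k) p p) →L[ℝ]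
        EuclideanSpace ℝ (Fin k)) ∘L
    mfderiv (𝓡 k) 𝓘(ℝ, EuclideanSpace ℝ (Fin k)) (extChartAt (𝓡 k) p) p

/-- The differential, at the coordinate point `x`, of the inverse of the preferred chart at `p`. -/
def dChartSymm (p : M) (x : EuclideanSpace ℝ (Fin k)) :
    EuclideanSpace ℝ (Fin k) →L[ℝ] TangentSpace (𝓡 k) ((extChartAt (𝓡 k) p).symm x) :=
  mfderiv 𝓘(ℝ, EuclideanSpace ℝ (Fin k)) (𝓡 k) (extChartAt (𝓡 k) p).symm x ∘L
    ((NormedSpace.fromTangentSpace (𝕜 := ℝ) x).symm :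
      EuclideanSpace ℝ (Fin k) →L[ℝ] TangentSpace 𝓘(ℝ, EuclideanSpace ℝ (Fin k)) x)

/-- The metric `g` in the coordinates of the preferred chart at `p`. -/
def metricInChart (g : SmoothMetric k M) (p : M) (x : EuclideanSpace ℝ (Fin k)) :
    EuclideanSpace ℝ (Fin k) →L[ℝ] EuclideanSpace ℝ (Fin k) →L[ℝ] ℝ :=
  LinearMap.toContinuousLinearMap
    (LinearMap.toContinuousLinearMap.toLinearMap ∘ₗ
      LinearMap.mk₂ ℝ
        (fun u v => g.inner ((extChartAt (𝓡 k) p).symm x) (dChartSymm p x u) (dChartSymm p x v))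
        (fun a b c => by rw [map_add, map_add, add_apply])
        (fun c a b => by rw [map_smul, map_smul, smul_apply])
        (fun a b c => by rw [map_add, map_add])
        (fun c a b => by rw [map_smul, map_smul]))

/-- The Riemann curvature tensor `⟨R(u, v) w, z⟩` of `(M, g)` at `p`, with
`R(X, Y) Z = ∇_X ∇_Y Z - ∇_Y ∇_X Z - ∇_[X, Y] Z`. -/
def riemann (g : SmoothMetric k M) (p : M) (u v w z : TangentSpace (𝓡 k) p) : ℝ :=
  metricInChart g p (extChartAt (𝓡 k) p p)
    (riemannCoord (metricInChart g p) (extChartAt (𝓡 k) p p) (coord p u) (coord p v) (coord p w))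
    (coord p z)

/-- The sectional curvature of the plane spanned by the independent vectors `u, v`. -/
def sectionalCurvature (g : SmoothMetric k M) (p : M) (u v : TangentSpace (𝓡 k) p) : ℝ :=
  riemann g p u v v u / (g.inner p u u * g.inner p v v - g.inner p u v ^ 2)

/-- `(M, g)` has constant sectional curvature `κ`. -/
def HasConstantCurvature (g : SmoothMetric k M) (κ : ℝ) : Prop :=
  ∀ (p : M) (u v : TangentSpace (𝓡 k) p), LinearIndependent ℝ ![u, v] →
    sectionalCurvature g p u v = κ

instance (p : M) : FiniteDimensional ℝ (TangentSpace (𝓡 k) p) :=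
  inferInstanceAs (FiniteDimensional ℝ (EuclideanSpace ℝ (Fin k)))

/-- `g_p` as an algebraic bilinear form. -/
def metricForm (g : SmoothMetric k M) (p : M) : LinearMap.BilinForm ℝ (TangentSpace (𝓡 k) p) :=
  LinearMap.mk₂ ℝ (fun u v => g.inner p u v)
    (by intros; simp) (by intros; simp) (by intros; simp) (by intros; simp)

theorem exists_tangentFrame (g : SmoothMetric k M) (p : M) :
    ∃ e : Module.Basis (Fin (Module.finrank ℝ (TangentSpace (𝓡 k) p))) ℝ (TangentSpace (𝓡 k) p),
      IsOrthonormalFor (fun v w => g.inner p v w) e :=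
  exists_orthonormal_basis (metricForm g p) (g.symm p) (g.pos p)

/-- A choice of an orthonormal basis of `T_p M`. -/
def tangentFrame (g : SmoothMetric k M) (p : M) :
    Module.Basis (Fin (Module.finrank ℝ (TangentSpace (𝓡 k) p))) ℝ (TangentSpace (𝓡 k) p) :=
  (exists_tangentFrame g p).choose

/-- The normalized scalar curvature `ρ = (2 / (k (k - 1))) ∑_{i < j} ⟨R(e_i, e_j) e_j, e_i⟩` of
`(M, g)` at `p`, for an orthonormal basis `e` of `T_p M`. -/
def normScalarCurv (g : SmoothMetric k M) (p : M) : ℝ :=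
  2 / ((k : ℝ) * (k - 1)) * ∑ i, ∑ j, if i < j then
    riemann g p (tangentFrame g p i) (tangentFrame g p j) (tangentFrame g p j) (tangentFrame g p i)
    else 0

end Manifold

/-! ### Submanifolds -/

section Submanifold

variable {n l : ℕ} {M N : Type*} [TopologicalSpace M] [ChartedSpace (EuclideanSpace ℝ (Fin n)) M]
  [IsManifold (𝓡 n) ∞ M] [TopologicalSpace N] [ChartedSpace (EuclideanSpace ℝ (Fin l)) N]
  [IsManifold (𝓡 l) ∞ N]

/-- `f : (M, g) → (N, h)` is a smooth isometric immersion: `M` is an immersed submanifold of `N`,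
with the induced metric. -/
def IsIsometricImmersion (g : SmoothMetric n M) (h : SmoothMetric l N) (f : M → N) : Prop :=
  ContMDiff (𝓡 n) (𝓡 l) ∞ f ∧ ∀ (p : M) (u v : TangentSpace (𝓡 n) p),
    h.inner (f p) (mfderiv (𝓡 n) (𝓡 l) f p u) (mfderiv (𝓡 n) (𝓡 l) f p v) = g.inner p u v

/-- The normal space `T_p^⊥ M`, a subspace of `T_{f p} N`. -/
def normalSpace (h : SmoothMetric l N) (f : M → N) (p : M) :
    Submodule ℝ (TangentSpace (𝓡 l) (f p)) where
  carrier := {ξ | ∀ u : TangentSpace (𝓡 n) p, h.inner (f p) (mfderiv (𝓡 n) (𝓡 l) f p u) ξ = 0}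
  add_mem' := by
    intro a b ha hb u
    rw [map_add, ha u, hb u, add_zero]
  zero_mem' := by
    intro u
    rw [map_zero]
  smul_mem' := by
    intro c a ha u
    rw [map_smul, ha u, smul_zero]

/-- The second fundamental form `II_ξ(u, v) = ⟨II(u, v), ξ⟩` in the normal direction `ξ`, computed
in the preferred charts at `p` and `f p`. -/
def secondFund (h : SmoothMetric l N) (f : M → N) (p : M) (ξ : normalSpace (n := n) h f p)
    (u v : TangentSpace (𝓡 n) p) : ℝ :=
  metricInChart h (f p) (extChartAt (𝓡 l) (f p) (f p))
    (secondFundCoord (metricInChart h (f p)) (writtenInExtChartAt (𝓡 n) (𝓡 l) p f)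
      (extChartAt (𝓡 n) p p) (coord p u) (coord p v))
    (coord (f p) ξ.1)

/-- `⟨R^⊥(u, v) ξ, η⟩`, where `R^⊥` is the curvature of the normal connection, computed in the
preferred charts at `p` and `f p`. -/
def normalCurv (h : SmoothMetric l N) (f : M → N) (p : M) (u v : TangentSpace (𝓡 n) p)
    (ξ η : normalSpace (n := n) h f p) : ℝ :=
  metricInChart h (f p) (extChartAt (𝓡 l) (f p) (f p))
    (normalCurvCoord (metricInChart h (f p)) (writtenInExtChartAt (𝓡 n) (𝓡 l) p f)
      (extChartAt (𝓡 n) p p) (coord p u) (coord p v) (coord (f p) ξ.1))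
    (coord (f p) η.1)

/-- `|II_p|`: the space of bilinear forms on `T_p M` that is spanned by the `II_ξ`. -/
def secondFundSpan (h : SmoothMetric l N) (f : M → N) (p : M) :
    Submodule ℝ (TangentSpace (𝓡 n) p → TangentSpace (𝓡 n) p → ℝ) :=
  Submodule.span ℝ (Set.range (secondFund h f p))

theorem exists_normalFrame (h : SmoothMetric l N) (f : M → N) (p : M) :
    ∃ ξ : Module.Basis (Fin (Module.finrank ℝ (normalSpace (n := n) h f p))) ℝ
        (normalSpace (n := n) h f p),
      IsOrthonormalFor (fun v w => h.inner (f p) v.1 w.1) ξ :=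
  exists_orthonormal_basis ((metricForm h (f p)).restrict (normalSpace (n := n) h f p))
    (fun v w => h.symm (f p) v.1 w.1) (fun v hv => h.pos (f p) v.1 (by simpa using hv))

/-- A choice of an orthonormal basis of `T_p^⊥ M`. -/
def normalFrame (h : SmoothMetric l N) (f : M → N) (p : M) :
    Module.Basis (Fin (Module.finrank ℝ (normalSpace (n := n) h f p))) ℝ
      (normalSpace (n := n) h f p) :=
  (exists_normalFrame h f p).choose

/-- The normalized normal scalar curvature
`ρ^⊥ = (2 / (n (n - 1))) (∑_{i < j} ∑_{r < s} ⟨R^⊥(e_i, e_j) ξ_r, ξ_s⟩²)^{1/2}` at `p`, for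
orthonormal bases `e` of `T_p M` and `ξ` of `T_p^⊥ M`. -/
def normNormalScalarCurv (g : SmoothMetric n M) (h : SmoothMetric l N) (f : M → N) (p : M) : ℝ :=
  2 / ((n : ℝ) * (n - 1)) * Real.sqrt (∑ i, ∑ j, if i < j then
    ∑ r, ∑ s, if r < s then
      normalCurv h f p (tangentFrame g p i) (tangentFrame g p j)
        (normalFrame h f p r) (normalFrame h f p s) ^ 2
      else 0
    else 0)

/-- The matrix `(B(e_i, e_j))` of the bilinear form `B`. -/
def matrixOf {V ι : Type*} (B : V → V → ℝ) (e : ι → V) : Matrix ι ι ℝ :=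
  Matrix.of fun i j => B (e i) (e j)

/-- A real symmetric matrix is austere if its nonzero eigenvalues occur in oppositely signed pairs,
that is, its spectrum (with multiplicities) is invariant under `x ↦ -x`. -/
def IsAustereMatrix {ι : Type*} [Fintype ι] [DecidableEq ι] (A : Matrix ι ι ℝ) : Prop :=
  A.IsSymm ∧ A.charpoly.roots.map (fun x => -x) = A.charpoly.roots

/-- The submanifold is austere: in every normal direction, the nonzero principal curvatures occur
in oppositely signed pairs. -/
def IsAustere (g : SmoothMetric n M) (h : SmoothMetric l N) (f : M → N) : Prop :=
  ∀ (p : M) (e : Module.Basis (Fin n) ℝ (TangentSpace (𝓡 n) p)),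
    IsOrthonormalFor (fun u v => g.inner p u v) e →
      ∀ ξ : normalSpace (n := n) h f p, IsAustereMatrix (matrixOf (secondFund h f p ξ) e)

/-- The space `Q(p, q)` of the matrices with block form `(0, a; aᵗ, 0)`, for `a` of size
`p × q`. -/
def austereQ (p q : ℕ) : Submodule ℝ (Matrix (Fin p ⊕ Fin q) (Fin p ⊕ Fin q) ℝ) where
  carrier := {A | ∃ a : Matrix (Fin p) (Fin q) ℝ, A = Matrix.fromBlocks 0 a a.transpose 0}
  add_mem' := by
    rintro _ _ ⟨a, rfl⟩ ⟨b, rfl⟩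
    exact ⟨a + b, by simp [Matrix.fromBlocks_add]⟩
  zero_mem' := ⟨0, by simp⟩
  smul_mem' := by
    rintro c _ ⟨a, rfl⟩
    exact ⟨c • a, by simp [Matrix.fromBlocks_smul]⟩

/-- The submanifold is of type `Q`: at each point `p`, there is an orthonormal basis of `T_p M` in
which the matrices of the forms in `|II_p|` lie in `Q`. -/
def IsOfType {ι : Type*} (Q : Submodule ℝ (Matrix ι ι ℝ)) (g : SmoothMetric n M)
    (h : SmoothMetric l N) (f : M → N) : Prop :=
  ∀ p : M, ∃ e : Module.Basis ι ℝ (TangentSpace (𝓡 n) p),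
    IsOrthonormalFor (fun u v => g.inner p u v) e ∧
      ∀ B ∈ secondFundSpan h f p, matrixOf B e ∈ Q

/-- The `n × n` matrix unit with entry `1` in position `(i, j)` and `0` elsewhere; rows and columns
are numbered from `0` to `n - 1`. -/
def matUnit (n i j : ℕ) : Matrix (Fin n) (Fin n) ℝ :=
  Matrix.of fun a b => if (a : ℕ) = i ∧ (b : ℕ) = j then 1 else 0

end Submanifold

end AustereSubmanifold

end

set_option maxSynthPendingDepth 3

/-! At a fixed point, a form of type Q(n-1,1) is determined by its off-diagonal block, a vector a_ξ
in ℝ^(n-1) depending linearly on the normal vector ξ. Everything is governed by the Gram matrix G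
with entries a_r · a_s, taken over an orthonormal normal frame (`gramForm`).

The maps ξ ↦ a_ξ and ξ ↦ II_ξ have the same kernel, so G has rank d (`posSemidef_gramForm`). Put C =
2/(n(n-1)). Each II_ξ is traceless, so the Gauss equation gives κ - ρ = C tr G
(`sub_normScalarCurv_eq`). In the Ricci equation only the pairs among the first n-1 tangent vectors
contribute, with the coordinates of a_r ∧ a_s, and Lagrange's identity gives ρ^⊥ = C √(((tr G)² - tr
G²)/2) (`normNormalScalarCurv_eq`). The inequality is therefore equivalent to (tr G)² ≤ d tr G²,
which is Cauchy–Schwarz for the d nonzero eigenvalues of G (`sq_trace_le_rank_mul`).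

Equality means that the nonzero eigenvalues share one value c. In a normal frame of eigenvectors,
the first d vectors a_r are orthogonal of length √c and the others vanish. Rotating the first n-1
tangent vectors so that these a_r lie along the axes gives the standard form with λ = √c
(`exists_frames`). Conversely, in the standard form G is λ² times a coordinate projection of rank d,
so Cauchy–Schwarz is sharp (`sq_sum_gramForm_eq`).

The geometric input is the pair of equations `IsImmersionOn.gauss` and `IsImmersionOn.ricci`, proved
in coordinates and transported through the preferred charts, together with the fact that constant
sectional curvature determines the whole curvature tensor (`curvatureLike_eq_zero`). -/

namespace AustereSubmanifold

/-! ### Levi-Civita connection and curvature in coordinates. -/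

section Coordinates

variable {E E' : Type*} [NormedAddCommGroup E] [NormedSpace ℝ E] [FiniteDimensional ℝ E]
  [NormedAddCommGroup E'] [NormedSpace ℝ E'] [FiniteDimensional ℝ E']

/-- `g` is a smooth Riemannian metric on the open subset `U` of a coordinate space. -/
structure IsMetricOn (g : E → E →L[ℝ] E →L[ℝ] ℝ) (U : Set E) : Prop where
  isOpen : IsOpen U
  contDiffOn : ContDiffOn ℝ ∞ g U
  symm : ∀ x ∈ U, ∀ v w, g x v w = g x w v
  pos : ∀ x ∈ U, ∀ v, v ≠ 0 → 0 < g x v v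

theorem differentiableAt_of_contDiffOn {f : E → E'} {U : Set E} (hf : ContDiffOn ℝ ∞ f U)
    (hU : IsOpen U) {x : E} (hx : x ∈ U) : DifferentiableAt ℝ f x :=
  (hf.contDiffAt (hU.mem_nhds hx)).differentiableAt (by simp)

theorem contDiffOn_fderiv_apply {f : E → E'} {U : Set E} (hf : ContDiffOn ℝ ∞ f U)
    (hU : IsOpen U) (v : E) : ContDiffOn ℝ ∞ (fun y => fderiv ℝ f y v) U :=
  (hf.fderiv_of_isOpen hU (by simp)).clm_apply contDiffOn_const

theorem fderiv_fderiv_comm {f : E → E'} {U : Set E} (hf : ContDiffOn ℝ ∞ f U)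
    (hU : IsOpen U) {x : E} (hx : x ∈ U) (u v : E) :
    fderiv ℝ (fun y => fderiv ℝ f y v) x u = fderiv ℝ (fun y => fderiv ℝ f y u) x v := by
  have hd : DifferentiableAt ℝ (fderiv ℝ f) x :=
    differentiableAt_of_contDiffOn (hf.fderiv_of_isOpen hU (by simp)) hU hx
  have hs : IsSymmSndFDerivAt ℝ f x :=
    (hf.contDiffAt (hU.mem_nhds hx)).isSymmSndFDerivAt
      (by simpa using WithTop.coe_le_coe.2 (OrderTop.le_top (2 : ℕ∞)))
  rw [fderiv_clm_apply hd (by fun_prop), fderiv_clm_apply hd (by fun_prop)]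
  simpa using hs u v

/-- Definiteness gives injectivity, and a finite-dimensional space and its dual have equal
dimension. This keeps the `inverse` in the Christoffel symbols and in the tangential projection from
being its default value. -/
theorem isInvertible_of_pos {B : E →L[ℝ] E →L[ℝ] ℝ} (hp : ∀ v, v ≠ 0 → 0 < B v v) :
    B.IsInvertible := by
  have hinj : Function.Injective B := by
    rw [injective_iff_map_eq_zero]
    intro v hv
    by_contra hne
    have := hp v hne
    rw [hv] at this
    simp at this
  have hfin : Module.finrank ℝ E = Module.finrank ℝ (E →L[ℝ] ℝ) := by
    rw [← LinearEquiv.finrank_eq (LinearMap.toContinuousLinearMap (𝕜 := ℝ) (E := E) (F' := ℝ))]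
    exact (Subspace.dual_finrank_eq).symm
  refine ⟨(LinearEquiv.ofInjectiveOfFinrankEq (B : E →ₗ[ℝ] E →L[ℝ] ℝ) hinj
    hfin).toContinuousLinearEquiv, ?_⟩
  ext v w
  rfl

theorem eq_of_forall_apply_eq {B : E →L[ℝ] E →L[ℝ] ℝ} (hp : ∀ v, v ≠ 0 → 0 < B v v) {a b : E}
    (h : ∀ z, B a z = B b z) : a = b := by
  by_contra hne
  have := hp (a - b) (sub_ne_zero.2 hne)
  rw [show B (a - b) = 0 by ext z; simp [h]] at this
  simp at this

/-- The bilinear form with values in the dual space whose `g`-dual is the Christoffel symbol. -/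
noncomputable def christoffelForm (g : E → E →L[ℝ] E →L[ℝ] ℝ) (x : E) :
    E →L[ℝ] E →L[ℝ] E →L[ℝ] ℝ :=
  (1 / 2 : ℝ) • (fderiv ℝ g x + (fderiv ℝ g x).flip -
    ((ContinuousLinearMap.flipₗᵢ ℝ E E ℝ).toContinuousLinearEquiv :
      (E →L[ℝ] E →L[ℝ] ℝ) →L[ℝ] (E →L[ℝ] E →L[ℝ] ℝ)) ∘L (fderiv ℝ g x).flip)

/-- The Christoffel symbols as a continuous bilinear map. -/
noncomputable def christoffelL (g : E → E →L[ℝ] E →L[ℝ] ℝ) (x : E) : E →L[ℝ] E →L[ℝ] E :=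
  (ContinuousLinearMap.compL ℝ E (E →L[ℝ] ℝ) E (g x).inverse) ∘L christoffelForm g x

theorem christoffelL_apply (g : E → E →L[ℝ] E →L[ℝ] ℝ) (x u v : E) :
    christoffelL g x u v = christoffel g x u v := rfl

namespace IsMetricOn

variable {g : E' → E' →L[ℝ] E' →L[ℝ] ℝ} {U' : Set E'} {F : E → E'} {U : Set E} {V W : E → E'}

theorem isInvertible (hg : IsMetricOn g U') {x : E'} (hx : x ∈ U') : (g x).IsInvertible :=
  isInvertible_of_pos (hg.pos x hx)

theorem differentiableAt (hg : IsMetricOn g U') {x : E'} (hx : x ∈ U') :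
    DifferentiableAt ℝ g x :=
  differentiableAt_of_contDiffOn hg.contDiffOn hg.isOpen hx

theorem fderiv_symm (hg : IsMetricOn g U') {x : E'} (hx : x ∈ U') (u v w : E') :
    fderiv ℝ g x u v w = fderiv ℝ g x u w v := by
  have h : (fun y => g y v w) =ᶠ[nhds x] fun y => g y w v := by
    filter_upwards [hg.isOpen.mem_nhds hx] with y hy using hg.symm y hy v w
  have hd := hg.differentiableAt hx
  have key : ∀ a b : E', fderiv ℝ (fun y => g y a b) x u = fderiv ℝ g x u a b := by
    intro a b
    rw [fderiv_clm_apply (by fun_prop) (by fun_prop), fderiv_clm_apply (by fun_prop) (by fun_prop)]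
    simp
  rw [← key, ← key, h.fderiv_eq]

theorem apply_christoffel (hg : IsMetricOn g U') {x : E'} (hx : x ∈ U') (u v w : E') :
    g x (christoffel g x u v) w =
      1 / 2 * (fderiv ℝ g x u v w + fderiv ℝ g x v u w - fderiv ℝ g x w u v) := by
  rw [christoffel, (hg.isInvertible hx).self_apply_inverse]
  simp

theorem christoffel_symm (hg : IsMetricOn g U') {x : E'} (hx : x ∈ U') (u v : E') :
    christoffel g x u v = christoffel g x v u := by
  refine eq_of_forall_apply_eq (hg.pos x hx) fun z => ?_
  rw [hg.apply_christoffel hx, hg.apply_christoffel hx, hg.fderiv_symm hx z]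
  ring

theorem christoffel_compat (hg : IsMetricOn g U') {x : E'} (hx : x ∈ U') (u v w : E') :
    g x (christoffel g x u v) w + g x v (christoffel g x u w) = fderiv ℝ g x u v w := by
  rw [hg.symm x hx v, hg.apply_christoffel hx, hg.apply_christoffel hx, hg.fderiv_symm hx u w v]
  ring

theorem contDiffOn_inverse (hg : IsMetricOn g U') :
    ContDiffOn ℝ ∞ (fun x => (g x).inverse) U' := by
  have : CompleteSpace E' := FiniteDimensional.complete ℝ E'
  intro x hx
  obtain ⟨e, he⟩ := hg.isInvertible hx
  have h1 : ContDiffAt ℝ ∞ ContinuousLinearMap.inverse (g x) := he ▸ contDiffAt_map_inverse e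
  exact h1.comp_contDiffWithinAt x (hg.contDiffOn x hx)

theorem contDiffOn_christoffelL (hg : IsMetricOn g U') : ContDiffOn ℝ ∞ (christoffelL g) U' := by
  have h1 : ContDiffOn ℝ ∞ (fderiv ℝ g) U' := hg.contDiffOn.fderiv_of_isOpen hg.isOpen (by simp)
  have h2 : ContDiffOn ℝ ∞ (fun x => (fderiv ℝ g x).flip) U' :=
    (ContinuousLinearMap.flipₗᵢ ℝ E' E' (E' →L[ℝ] ℝ)).contDiff.comp_contDiffOn h1
  have h3 : ContDiffOn ℝ ∞ (christoffelForm g) U' :=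
    ((h1.add h2).sub (contDiffOn_const.clm_comp h2)).const_smul _
  have h4 : ContDiffOn ℝ ∞ (fun x => ContinuousLinearMap.compL ℝ E' (E' →L[ℝ] ℝ) E'
      (g x).inverse) U' :=
    (ContinuousLinearMap.contDiff _).comp_contDiffOn hg.contDiffOn_inverse
  exact h4.clm_comp h3

theorem contDiffOn_covDerivAlong (hg : IsMetricOn g U') (hU : IsOpen U)
    (hF : ContDiffOn ℝ ∞ F U) (hm : Set.MapsTo F U U') (hV : ContDiffOn ℝ ∞ V U) (u : E) :
    ContDiffOn ℝ ∞ (covDerivAlong g F V u) U :=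
  (contDiffOn_fderiv_apply hV hU u).add
    (((hg.contDiffOn_christoffelL.comp hF hm).clm_apply (contDiffOn_fderiv_apply hF hU u)).clm_apply
      hV)

/-- The Levi-Civita connection is compatible with the metric. -/
theorem fderiv_apply_apply (hg : IsMetricOn g U') {x : E} (hx : F x ∈ U')
    (hF : DifferentiableAt ℝ F x) (hV : DifferentiableAt ℝ V x) (hW : DifferentiableAt ℝ W x)
    (u : E) :
    fderiv ℝ (fun y => g (F y) (V y) (W y)) x u =
      g (F x) (covDerivAlong g F V u x) (W x) + g (F x) (V x) (covDerivAlong g F W u x) := by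
  have hgd := hg.differentiableAt hx
  have hgF : DifferentiableAt ℝ (fun y => g (F y)) x := hgd.comp x hF
  have h1 : fderiv ℝ (fun y => g (F y)) x u = fderiv ℝ g (F x) (fderiv ℝ F x u) := by
    rw [show (fun y => g (F y)) = g ∘ F from rfl, fderiv_comp x hgd hF]
    rfl
  rw [fderiv_clm_apply (by fun_prop) hW, fderiv_clm_apply hgF hV]
  simp only [add_apply, ContinuousLinearMap.comp_apply,
    ContinuousLinearMap.flip_apply, h1, covDerivAlong, map_add]
  rw [← hg.christoffel_compat hx]
  ring

/-- The Levi-Civita connection is torsion free. -/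
theorem covDerivAlong_fderiv_symm (hg : IsMetricOn g U') (hU : IsOpen U)
    (hF : ContDiffOn ℝ ∞ F U) {x : E} (hx : x ∈ U) (hFx : F x ∈ U') (u v : E) :
    covDerivAlong g F (fun y => fderiv ℝ F y v) u x =
      covDerivAlong g F (fun y => fderiv ℝ F y u) v x := by
  rw [covDerivAlong, covDerivAlong, fderiv_fderiv_comm hF hU hx u v, hg.christoffel_symm hFx]

end IsMetricOn

/-- The curvature tensor in terms of the Christoffel symbols. -/
noncomputable def curvatureForm (g : E → E →L[ℝ] E →L[ℝ] ℝ) (x u v w : E) : E :=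
  fderiv ℝ (christoffelL g) x u v w - fderiv ℝ (christoffelL g) x v u w +
    (christoffelL g x u (christoffelL g x v w) - christoffelL g x v (christoffelL g x u w))

/-- The second derivatives of `V` and `F` are symmetric and cancel in the commutator, as do the
terms with one derivative of `V`. What remains depends on `F` only through its value and
differential at `x`. The case `F = id` identifies this remainder with `riemannCoord`, so the
curvature along a map is the pulled-back ambient curvature. -/
theorem IsMetricOn.covDerivAlong_comm_eq_curvatureForm {g : E' → E' →L[ℝ] E' →L[ℝ] ℝ}
    {U' : Set E'} {F : E → E'} {U : Set E} {V : E → E'}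
    (hg : IsMetricOn g U') (hU : IsOpen U)
    (hF : ContDiffOn ℝ ∞ F U) (hV : ContDiffOn ℝ ∞ V U) {x : E} (hx : x ∈ U)
    (hFx : F x ∈ U') (u v : E) :
    covDerivAlong g F (covDerivAlong g F V v) u x - covDerivAlong g F (covDerivAlong g F V u) v x =
      curvatureForm g (F x) (fderiv ℝ F x u) (fderiv ℝ F x v) (V x) := by
  have hΓ : DifferentiableAt ℝ (christoffelL g) (F x) :=
    differentiableAt_of_contDiffOn hg.contDiffOn_christoffelL hg.isOpen hFx
  have hFd := differentiableAt_of_contDiffOn hF hU hx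
  have hVd := differentiableAt_of_contDiffOn hV hU hx
  have hΓF : DifferentiableAt ℝ (fun y => christoffelL g (F y)) x := hΓ.comp x hFd
  have hΓF' : ∀ a, fderiv ℝ (fun y => christoffelL g (F y)) x a =
      fderiv ℝ (christoffelL g) (F x) (fderiv ℝ F x a) := by
    intro a
    rw [show (fun y => christoffelL g (F y)) = christoffelL g ∘ F from rfl, fderiv_comp x hΓ hFd]
    rfl
  have hFa : ∀ a, DifferentiableAt ℝ (fun y => fderiv ℝ F y a) x := fun a =>
    differentiableAt_of_contDiffOn (contDiffOn_fderiv_apply hF hU a) hU hx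
  have hVa : ∀ a, DifferentiableAt ℝ (fun y => fderiv ℝ V y a) x := fun a =>
    differentiableAt_of_contDiffOn (contDiffOn_fderiv_apply hV hU a) hU hx
  have key : ∀ a b, fderiv ℝ (covDerivAlong g F V b) x a =
      fderiv ℝ (fun y => fderiv ℝ V y b) x a +
      (fderiv ℝ (christoffelL g) (F x) (fderiv ℝ F x a) (fderiv ℝ F x b) (V x) +
        christoffelL g (F x) (fderiv ℝ (fun y => fderiv ℝ F y b) x a) (V x) +
        christoffelL g (F x) (fderiv ℝ F x b) (fderiv ℝ V x a)) := by
    intro a b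
    have h0 : covDerivAlong g F V b = fun y => fderiv ℝ V y b +
        christoffelL g (F y) (fderiv ℝ F y b) (V y) := rfl
    have h1 : DifferentiableAt ℝ (fun y => christoffelL g (F y) (fderiv ℝ F y b)) x :=
      hΓF.clm_apply (hFa b)
    have h2 : DifferentiableAt ℝ (fun y => christoffelL g (F y) (fderiv ℝ F y b) (V y)) x :=
      h1.clm_apply hVd
    rw [h0, fderiv_fun_add (hVa b) h2, fderiv_clm_apply h1 hVd, fderiv_clm_apply hΓF (hFa b)]
    simp only [add_apply, ContinuousLinearMap.comp_apply,
      ContinuousLinearMap.flip_apply, hΓF']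
    abel
  change (fderiv ℝ (covDerivAlong g F V v) x u +
      christoffelL g (F x) (fderiv ℝ F x u) (covDerivAlong g F V v x)) -
    (fderiv ℝ (covDerivAlong g F V u) x v +
      christoffelL g (F x) (fderiv ℝ F x v) (covDerivAlong g F V u x)) = _
  rw [key, key, fderiv_fderiv_comm hV hU hx u v,
    fderiv_fderiv_comm hF hU hx u v]
  simp only [← christoffelL_apply, covDerivAlong, map_add, curvatureForm]
  abel

theorem IsMetricOn.riemannCoord_eq {g : E → E →L[ℝ] E →L[ℝ] ℝ} {U : Set E} (hg : IsMetricOn g U)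
    {x : E} (hx : x ∈ U) (u v w : E) : riemannCoord g x u v w = curvatureForm g x u v w := by
  have := hg.covDerivAlong_comm_eq_curvatureForm (F := id) (V := fun _ => w) hg.isOpen
    contDiffOn_id contDiffOn_const hx hx u v
  simpa [riemannCoord] using this

/-- The curvature of the connection pulled back along `F`. -/
theorem IsMetricOn.covDerivAlong_comm {g : E' → E' →L[ℝ] E' →L[ℝ] ℝ}
    {U' : Set E'} {F : E → E'} {U : Set E} {V : E → E'}
    (hg : IsMetricOn g U') (hU : IsOpen U)
    (hF : ContDiffOn ℝ ∞ F U) (hV : ContDiffOn ℝ ∞ V U) {x : E} (hx : x ∈ U)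
    (hFx : F x ∈ U') (u v : E) :
    covDerivAlong g F (covDerivAlong g F V v) u x - covDerivAlong g F (covDerivAlong g F V u) v x =
      riemannCoord g (F x) (fderiv ℝ F x u) (fderiv ℝ F x v) (V x) := by
  rw [hg.covDerivAlong_comm_eq_curvatureForm hU hF hV hx hFx, hg.riemannCoord_eq hFx]

end Coordinates

section Coordinates

variable {E E' : Type*} [NormedAddCommGroup E] [NormedSpace ℝ E] [FiniteDimensional ℝ E]
  [NormedAddCommGroup E'] [NormedSpace ℝ E'] [FiniteDimensional ℝ E']

/-! ### Symmetries of the curvature tensor -/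

/-- A tensor with the symmetries of a curvature tensor vanishes if its sectional curvatures do. -/
theorem curvatureLike_eq_zero {V : Type*} [AddCommGroup V] (B : V → V → V → V → ℝ)
    (add₁ : ∀ a b v w z, B (a + b) v w z = B a v w z + B b v w z)
    (add₃ : ∀ u v a b z, B u v (a + b) z = B u v a z + B u v b z)
    (anti₁ : ∀ u v w z, B v u w z = -B u v w z) (anti₂ : ∀ u v w z, B u v z w = -B u v w z)
    (bianchi : ∀ u v w z, B u v w z + B v w u z + B w u v z = 0)
    (h : ∀ u v, B u v v u = 0) (u v w z : V) : B u v w z = 0 := by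
  have add₂ : ∀ u a b w z, B u (a + b) w z = B u a w z + B u b w z := fun u a b w z => by
    rw [anti₁, add₁, anti₁ u a, anti₁ u b]; ring
  have add₄ : ∀ u v w a b, B u v w (a + b) = B u v w a + B u v w b := fun u v w a b => by
    rw [anti₂, add₃, anti₂ u v w a, anti₂ u v w b]; ring
  -- Pair symmetry is the usual combination of the four cyclic Bianchi identities with both
  -- antisymmetries.
  have pair : ∀ u v w z, B u v w z = B w z u v := fun u v w z => by
    have h1 := bianchi u v w z
    have h2 := bianchi v w z u
    have h3 := bianchi w z u v
    have h4 := bianchi z u v w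
    linarith [anti₂ v w z u, anti₂ w z u v, anti₂ z u v w, anti₂ u v w z, anti₁ u v w z,
      anti₁ v w z u, anti₁ w z u v, anti₁ z u v w, anti₁ w u v z, anti₂ w u v z, anti₁ u w z v,
      anti₂ u w z v, anti₁ v z u w, anti₂ v z u w, anti₂ z v w u, anti₁ v z w u, anti₁ w u z v,
      anti₁ z v u w, anti₂ v w u z, anti₂ w z v u, anti₂ z u w v, anti₂ u v z w]
  have step : ∀ u v w, B u v w u = 0 := fun u v w => by
    have h1 := h u (v + w)
    rw [add₂, add₃, add₃, h, h] at h1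
    have h2 : B u w v u = B u v w u := by
      rw [pair, anti₁, anti₂]; ring
    linarith
  have step' : ∀ u v w z, B u v w z = -B z v w u := fun u v w z => by
    have h1 := step (u + z) v w
    rw [add₁, add₄, add₄, step, step] at h1
    linarith
  -- Polarisation has made `B` antisymmetric under exchange of its outer arguments. With the other
  -- symmetries this makes `B` invariant under cyclic permutation of the first three, so Bianchi
  -- reads 3B = 0.
  have h1 : B v w u z = B u v w z := by
    rw [step' v w u z, anti₁ w z, pair w z u v]; ring
  have h2 : B w u v z = B u v w z := by
    rw [step' w u v z, anti₁ u z, pair u z v w, h1]; ring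
  linarith [bianchi u v w z]

namespace IsMetricOn

variable {g : E → E →L[ℝ] E →L[ℝ] ℝ} {U : Set E} {x : E}

theorem covDerivAlong_id_const (u w : E) :
    covDerivAlong g id (fun _ => w) u = fun y => christoffel g y u w := by
  ext y
  simp [covDerivAlong]

theorem contDiffOn_covDerivAlong_id (hg : IsMetricOn g U) {V : E → E} (hV : ContDiffOn ℝ ∞ V U)
    (u : E) : ContDiffOn ℝ ∞ (covDerivAlong g id V u) U :=
  hg.contDiffOn_covDerivAlong hg.isOpen contDiffOn_id (Set.mapsTo_id U) hV u

/-- For constant fields, torsion-freeness says that ∇_b c = ∇_c b near `x`. The six second covariant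
derivatives then cancel in pairs. -/
theorem riemannCoord_bianchi (hg : IsMetricOn g U) (hx : x ∈ U) (u v w : E) :
    riemannCoord g x u v w + riemannCoord g x v w u + riemannCoord g x w u v = 0 := by
  have key : ∀ a b c, covDerivAlong g id (covDerivAlong g id (fun _ => c) b) a x =
      covDerivAlong g id (covDerivAlong g id (fun _ => b) c) a x := by
    intro a b c
    have h : covDerivAlong g id (fun _ => c) b =ᶠ[nhds x] covDerivAlong g id (fun _ => b) c := by
      filter_upwards [hg.isOpen.mem_nhds hx] with y hy
      rw [covDerivAlong_id_const, covDerivAlong_id_const]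
      exact hg.christoffel_symm hy b c
    rw [covDerivAlong, h.fderiv_eq, h.self_of_nhds]
    rfl
  rw [riemannCoord, riemannCoord, riemannCoord, key u v w, key v w u, key w u v]
  abel

/-- The second partial derivatives of the function g(w, z) commute. Expanded by metric
compatibility, the mixed terms g(∇w, ∇z) are symmetric in the two directions and drop out, leaving
g(Rw, z) + g(w, Rz) = 0. -/
theorem apply_riemannCoord_antisymm (hg : IsMetricOn g U) (hx : x ∈ U) (u v w z : E) :
    g x (riemannCoord g x u v z) w = -g x (riemannCoord g x u v w) z := by
  have hc : ∀ c b, ContDiffOn ℝ ∞ (covDerivAlong g id (fun _ => c) b) U := fun c b =>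
    hg.contDiffOn_covDerivAlong_id contDiffOn_const b
  have hd : ∀ c b, ∀ y ∈ U, DifferentiableAt ℝ (covDerivAlong g id (fun _ => c) b) y :=
    fun c b y hy => differentiableAt_of_contDiffOn (hc c b) hg.isOpen hy
  have hgwz : ContDiffOn ℝ ∞ (fun y => g y w z) U :=
    (hg.contDiffOn.clm_apply contDiffOn_const).clm_apply contDiffOn_const
  have h1 : ∀ b, ∀ y ∈ U, fderiv ℝ (fun y => g y w z) y b =
      g y (covDerivAlong g id (fun _ => w) b y) z + g y w (covDerivAlong g id (fun _ => z) b y) :=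
    fun b y hy => hg.fderiv_apply_apply (F := id) (V := fun _ => w) (W := fun _ => z) hy
      differentiableAt_id (differentiableAt_const _) (differentiableAt_const _) b
  have h2 : ∀ a b, fderiv ℝ (fun y => fderiv ℝ (fun y => g y w z) y b) x a =
      (g x (covDerivAlong g id (covDerivAlong g id (fun _ => w) b) a x) z +
        g x (covDerivAlong g id (fun _ => w) b x) (covDerivAlong g id (fun _ => z) a x)) +
      (g x (covDerivAlong g id (fun _ => w) a x) (covDerivAlong g id (fun _ => z) b x) +
        g x w (covDerivAlong g id (covDerivAlong g id (fun _ => z) b) a x)) := by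
    intro a b
    have he : (fun y => fderiv ℝ (fun y => g y w z) y b) =ᶠ[nhds x] fun y =>
        g y (covDerivAlong g id (fun _ => w) b y) z +
          g y w (covDerivAlong g id (fun _ => z) b y) := by
      filter_upwards [hg.isOpen.mem_nhds hx] with y hy using h1 b y hy
    have hgd := hg.differentiableAt hx
    have := hd w b x hx
    have := hd z b x hx
    rw [he.fderiv_eq, fderiv_fun_add (by fun_prop) (by fun_prop)]
    exact congrArg₂ (· + ·)
      (hg.fderiv_apply_apply (F := id) (W := fun _ => z) hx differentiableAt_id
        (hd w b x hx) (differentiableAt_const _) a)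
      (hg.fderiv_apply_apply (F := id) (V := fun _ => w) hx differentiableAt_id
        (differentiableAt_const _) (hd z b x hx) a)
  have h3 := fderiv_fderiv_comm hgwz hg.isOpen hx u v
  rw [h2, h2] at h3
  rw [riemannCoord, riemannCoord, map_sub, sub_apply, map_sub, sub_apply,
    hg.symm x hx _ w, hg.symm x hx _ w]
  linarith

/-- Constant sectional curvature at a point determines the curvature tensor. -/
theorem apply_riemannCoord_of_sectional (hg : IsMetricOn g U) (hx : x ∈ U) {κ : ℝ}
    (hK : ∀ u v, LinearIndependent ℝ ![u, v] →
      g x (riemannCoord g x u v v) u = κ * (g x u u * g x v v - g x u v ^ 2)) (u v w z : E) :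
    g x (riemannCoord g x u v w) z = κ * (g x u z * g x v w - g x u w * g x v z) := by
  have anti : ∀ u v w, riemannCoord g x v u w = -riemannCoord g x u v w := fun u v w => by
    rw [riemannCoord, riemannCoord]; abel
  have hK' : ∀ u v, g x (riemannCoord g x u v v) u = κ * (g x u u * g x v v - g x u v ^ 2) := by
    intro u v
    by_cases h : LinearIndependent ℝ ![u, v]
    · exact hK u v h
    -- On dependent pairs `hK` gives nothing, but both sides vanish: for v = c u the curvature is c²
    -- R(u, u)u = 0.
    · by_cases hu : u = 0
      · subst hu; simp
      · rw [LinearIndependent.pair_iff' hu] at h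
        push Not at h
        obtain ⟨c, rfl⟩ := h
        have h0 : riemannCoord g x u u u = 0 := by
          rw [riemannCoord, sub_self]
        have h1 : riemannCoord g x u (c • u) (c • u) = 0 := by
          rw [hg.riemannCoord_eq hx] at h0 ⊢
          have : curvatureForm g x u (c • u) (c • u) = (c * c) • curvatureForm g x u u u := by
            simp only [curvatureForm, map_smul, smul_apply]
            module
          rw [this, h0, smul_zero]
        rw [h1]
        simp only [map_smul, smul_apply, smul_eq_mul, map_zero, zero_apply]
        ring
  rw [← sub_eq_zero]
  -- The difference from the constant-curvature model is itself curvature-like, and its sectional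
  -- curvatures vanish.
  refine curvatureLike_eq_zero (fun u v w z => g x (riemannCoord g x u v w) z -
    κ * (g x u z * g x v w - g x u w * g x v z)) ?_ ?_ ?_ ?_ ?_ ?_ u v w z
  · intro a b v w z
    simp only [hg.riemannCoord_eq hx, curvatureForm, map_add, map_sub, add_apply, sub_apply]
    ring
  · intro u v a b z
    simp only [hg.riemannCoord_eq hx, curvatureForm, map_add, map_sub, add_apply, sub_apply]
    ring
  · intro u v w z
    simp only [anti u v, map_neg, neg_apply]
    ring
  · intro u v w z
    simp only [hg.apply_riemannCoord_antisymm hx u v w z]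
    ring
  · intro u v w z
    have h := congrArg (fun t => g x t z) (hg.riemannCoord_bianchi hx u v w)
    simp only [map_add, add_apply, map_zero, zero_apply] at h
    simp only [hg.symm x hx w u, hg.symm x hx w v, hg.symm x hx v u]
    linarith
  · intro u v
    simp only [hK', hg.symm x hx v u]
    ring

/-- The curvature at a point only depends on the metric near the point. -/
theorem _root_.AustereSubmanifold.riemannCoord_congr {g g' : E → E →L[ℝ] E →L[ℝ] ℝ} {x : E}
    (h : g =ᶠ[nhds x] g') : riemannCoord g x = riemannCoord g' x := by
  have h1 : ∀ a w, covDerivAlong g id (fun _ => w) a =ᶠ[nhds x]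
      covDerivAlong g' id (fun _ => w) a := by
    intro a w
    rw [covDerivAlong_id_const, covDerivAlong_id_const]
    filter_upwards [h, h.fderiv (𝕜 := ℝ)] with y hy hy'
    rw [christoffel, christoffel, hy, hy']
  have h2 : ∀ u v, christoffel g x u v = christoffel g' x u v := by
    intro u v
    rw [christoffel, christoffel, h.self_of_nhds, h.fderiv_eq]
  ext u v w
  simp only [riemannCoord]
  have h3 : ∀ a b, covDerivAlong g id (covDerivAlong g id (fun _ => w) b) a x =
      covDerivAlong g' id (covDerivAlong g' id (fun _ => w) b) a x := by
    intro a b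
    change fderiv ℝ (covDerivAlong g id (fun _ => w) b) x a + christoffel g x _ _ =
      fderiv ℝ (covDerivAlong g' id (fun _ => w) b) x a + christoffel g' x _ _
    rw [(h1 b w).fderiv_eq, (h1 b w).self_of_nhds, h2]
  rw [h3, h3]

end IsMetricOn

end Coordinates

/-! ### Immersions in coordinates: the Gauss and Ricci equations. -/

section Coordinates

variable {E E' : Type*} [NormedAddCommGroup E] [NormedSpace ℝ E] [FiniteDimensional ℝ E]
  [NormedAddCommGroup E'] [NormedSpace ℝ E'] [FiniteDimensional ℝ E']

/-- `F` is a smooth immersion of `U` into the coordinate domain `U'` with the metric `g`. -/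
structure IsImmersionOn (g : E' → E' →L[ℝ] E' →L[ℝ] ℝ) (F : E → E') (U : Set E) (U' : Set E') :
    Prop where
  metric : IsMetricOn g U'
  isOpen : IsOpen U
  contDiffOn : ContDiffOn ℝ ∞ F U
  mapsTo : Set.MapsTo F U U'
  injective : ∀ x ∈ U, Function.Injective (fderiv ℝ F x)

/-- The vector that `dF_x` maps to the tangential part of `w`. -/
noncomputable def tangentCoord (g : E' → E' →L[ℝ] E' →L[ℝ] ℝ) (F : E → E') (x : E) (w : E') : E :=
  (inducedMetric g F x).inverse ((g (F x) w).comp (fderiv ℝ F x))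

theorem normalProj_eq (g : E' → E' →L[ℝ] E' →L[ℝ] ℝ) (F : E → E') (x : E) (w : E') :
    normalProj g F x w = w - fderiv ℝ F x (tangentCoord g F x w) := rfl

namespace IsImmersionOn

variable {g : E' → E' →L[ℝ] E' →L[ℝ] ℝ} {F : E → E'} {U : Set E} {U' : Set E'} {x : E}
  {V : E → E'}

theorem contDiffOn_fderiv (hF : IsImmersionOn g F U U') : ContDiffOn ℝ ∞ (fderiv ℝ F) U :=
  hF.contDiffOn.fderiv_of_isOpen hF.isOpen (by simp)

theorem differentiableAt (hF : IsImmersionOn g F U U') (hx : x ∈ U) : DifferentiableAt ℝ F x :=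
  differentiableAt_of_contDiffOn hF.contDiffOn hF.isOpen hx

theorem isMetricOn_inducedMetric (hF : IsImmersionOn g F U U') :
    IsMetricOn (inducedMetric g F) U where
  isOpen := hF.isOpen
  contDiffOn := by
    have h1 : ContDiffOn ℝ ∞ (fun y => g (F y)) U :=
      hF.metric.contDiffOn.comp hF.contDiffOn hF.mapsTo
    refine contDiffOn_clm_apply.2 fun v => contDiffOn_clm_apply.2 fun w => ?_
    exact (h1.clm_apply (contDiffOn_fderiv_apply hF.contDiffOn hF.isOpen v)).clm_apply
      (contDiffOn_fderiv_apply hF.contDiffOn hF.isOpen w)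
  symm x hx v w := hF.metric.symm _ (hF.mapsTo hx) _ _
  pos x hx v hv := hF.metric.pos _ (hF.mapsTo hx) _ fun h =>
    hv (hF.injective x hx (h.trans (map_zero _).symm))

theorem apply_tangentCoord (hF : IsImmersionOn g F U U') (hx : x ∈ U) (w : E') (z : E) :
    inducedMetric g F x (tangentCoord g F x w) z = g (F x) w (fderiv ℝ F x z) := by
  rw [tangentCoord, (hF.isMetricOn_inducedMetric.isInvertible hx).self_apply_inverse]
  rfl

theorem apply_normalProj_fderiv (hF : IsImmersionOn g F U U') (hx : x ∈ U) (w : E') (z : E) :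
    g (F x) (normalProj g F x w) (fderiv ℝ F x z) = 0 := by
  rw [normalProj_eq, map_sub, sub_apply, ← hF.apply_tangentCoord hx]
  exact sub_self _

theorem _root_.AustereSubmanifold.apply_normalProj_of_normal (w η : E')
    (hη : ∀ z, g (F x) (fderiv ℝ F x z) η = 0) :
    g (F x) (normalProj g F x w) η = g (F x) w η := by
  rw [normalProj_eq, map_sub, sub_apply, hη, sub_zero]

/-- Pythagoras. In the Gauss equation it turns a full product minus a tangential product into a
product of second fundamental forms. -/
theorem apply_normalProj_normalProj (hF : IsImmersionOn g F U U') (hx : x ∈ U) (a b : E') :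
    g (F x) (normalProj g F x a) (normalProj g F x b) =
      g (F x) a b - inducedMetric g F x (tangentCoord g F x a) (tangentCoord g F x b) := by
  rw [normalProj_eq g F x b, map_sub, hF.apply_normalProj_fderiv hx, sub_zero, normalProj_eq,
    map_sub, sub_apply, hF.metric.symm _ (hF.mapsTo hx) (fderiv ℝ F x _) b, ← hF.apply_tangentCoord hx,
    hF.isMetricOn_inducedMetric.symm x hx]

theorem normalProj_of_normal (hF : IsImmersionOn g F U U') (hx : x ∈ U) (ξ : E')
    (hξ : ∀ z, g (F x) (fderiv ℝ F x z) ξ = 0) : normalProj g F x ξ = ξ := by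
  have h0 : (g (F x) ξ).comp (fderiv ℝ F x) = 0 := by
    ext z
    exact (hF.metric.symm _ (hF.mapsTo hx) _ _).trans (hξ z)
  rw [normalProj_eq, tangentCoord, h0, map_zero, map_zero, sub_zero]

theorem contDiffOn_tangentCoord (hF : IsImmersionOn g F U U') (hV : ContDiffOn ℝ ∞ V U) :
    ContDiffOn ℝ ∞ (fun y => tangentCoord g F y (V y)) U :=
  hF.isMetricOn_inducedMetric.contDiffOn_inverse.clm_apply
    (((hF.metric.contDiffOn.comp hF.contDiffOn hF.mapsTo).clm_apply hV).clm_comp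
      hF.contDiffOn_fderiv)

theorem contDiffOn_normalProj (hF : IsImmersionOn g F U U') (hV : ContDiffOn ℝ ∞ V U) :
    ContDiffOn ℝ ∞ (fun y => normalProj g F y (V y)) U :=
  hV.sub (hF.contDiffOn_fderiv.clm_apply (hF.contDiffOn_tangentCoord hV))

theorem contDiffOn_covDerivAlong (hF : IsImmersionOn g F U U') (hV : ContDiffOn ℝ ∞ V U) (u : E) :
    ContDiffOn ℝ ∞ (covDerivAlong g F V u) U :=
  hF.metric.contDiffOn_covDerivAlong hF.isOpen hF.contDiffOn hF.mapsTo hV u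

theorem covDerivAlong_fderiv_eq (hF : IsImmersionOn g F U U') (hx : x ∈ U) (u v : E) :
    covDerivAlong g F (fun y => fderiv ℝ F y v) u x =
      fderiv ℝ (fderiv ℝ F) x u v + christoffelL g (F x) (fderiv ℝ F x u) (fderiv ℝ F x v) := by
  rw [covDerivAlong, fderiv_clm_apply
    (differentiableAt_of_contDiffOn hF.contDiffOn_fderiv hF.isOpen hx) (by fun_prop)]
  simp [christoffelL_apply]

theorem fderiv_inducedMetric (hF : IsImmersionOn g F U U') (hx : x ∈ U) (u v w : E) :
    fderiv ℝ (inducedMetric g F) x u v w =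
      g (F x) (covDerivAlong g F (fun y => fderiv ℝ F y v) u x) (fderiv ℝ F x w) +
      g (F x) (fderiv ℝ F x v) (covDerivAlong g F (fun y => fderiv ℝ F y w) u x) := by
  have hd := hF.isMetricOn_inducedMetric.differentiableAt hx
  have hFd : ∀ v, DifferentiableAt ℝ (fun y => fderiv ℝ F y v) x := fun v =>
    differentiableAt_of_contDiffOn (contDiffOn_fderiv_apply hF.contDiffOn hF.isOpen v) hF.isOpen hx
  rw [← hF.metric.fderiv_apply_apply (hF.mapsTo hx) (hF.differentiableAt hx) (hFd v) (hFd w)]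
  have : fderiv ℝ (fun y => inducedMetric g F y v w) x u =
      fderiv ℝ (inducedMetric g F) x u v w := by
    rw [fderiv_clm_apply (by fun_prop) (by fun_prop), fderiv_clm_apply (by fun_prop) (by fun_prop)]
    simp
  exact this.symm

/-- The tangential part of the ambient connection is the Levi-Civita connection of the induced
metric. -/
theorem apply_christoffel_inducedMetric (hF : IsImmersionOn g F U U') (hx : x ∈ U) (u w z : E) :
    inducedMetric g F x (christoffel (inducedMetric g F) x u w) z =
      g (F x) (covDerivAlong g F (fun y => fderiv ℝ F y w) u x) (fderiv ℝ F x z) := by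
  have hs := hF.metric.covDerivAlong_fderiv_symm hF.isOpen hF.contDiffOn hx (hF.mapsTo hx)
  have hg := hF.metric.symm _ (hF.mapsTo hx)
  rw [hF.isMetricOn_inducedMetric.apply_christoffel hx, hF.fderiv_inducedMetric hx,
    hF.fderiv_inducedMetric hx, hF.fderiv_inducedMetric hx, hs w u, hs z u, hs z w,
    hg (fderiv ℝ F x w), hg (fderiv ℝ F x u)]
  ring

theorem tangentCoord_covDerivAlong_fderiv (hF : IsImmersionOn g F U U') (hx : x ∈ U) (u w : E) :
    tangentCoord g F x (covDerivAlong g F (fun y => fderiv ℝ F y w) u x) =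
      christoffel (inducedMetric g F) x u w :=
  eq_of_forall_apply_eq (hF.isMetricOn_inducedMetric.pos x hx) fun z => by
    rw [hF.apply_tangentCoord hx, hF.apply_christoffel_inducedMetric hx]

/-- The Gauss equation. -/
theorem gauss (hF : IsImmersionOn g F U U') (hx : x ∈ U) (u v w z : E) :
    inducedMetric g F x (riemannCoord (inducedMetric g F) x u v w) z =
      g (F x) (riemannCoord g (F x) (fderiv ℝ F x u) (fderiv ℝ F x v) (fderiv ℝ F x w))
        (fderiv ℝ F x z) +
      (g (F x) (secondFundCoord g F x v w) (secondFundCoord g F x u z) -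
        g (F x) (secondFundCoord g F x u w) (secondFundCoord g F x v z)) := by
  have hG := hF.isMetricOn_inducedMetric
  have hFc : ∀ v, ContDiffOn ℝ ∞ (fun y => fderiv ℝ F y v) U := fun v =>
    contDiffOn_fderiv_apply hF.contDiffOn hF.isOpen v
  -- The function ⟨∇_b w, z⟩ has the same values for the induced and the ambient connection.
  -- Differentiating it along `a` by both compatibility formulas and comparing, the first-order
  -- products differ by the product of the normal parts.
  have key : ∀ a b, inducedMetric g F x (covDerivAlong (inducedMetric g F) id
      (covDerivAlong (inducedMetric g F) id (fun _ => w) b) a x) z =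
      g (F x) (covDerivAlong g F (covDerivAlong g F (fun y => fderiv ℝ F y w) b) a x)
        (fderiv ℝ F x z) +
      g (F x) (secondFundCoord g F x b w) (secondFundCoord g F x a z) := by
    intro a b
    have he : (fun y => inducedMetric g F y
        (covDerivAlong (inducedMetric g F) id (fun _ => w) b y) z) =ᶠ[nhds x]
        fun y => g (F y) (covDerivAlong g F (fun y => fderiv ℝ F y w) b y) (fderiv ℝ F y z) := by
      filter_upwards [hF.isOpen.mem_nhds hx] with y hy
      rw [← hF.apply_christoffel_inducedMetric hy]
      simp [covDerivAlong]
    have h1 := hG.fderiv_apply_apply (F := id)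
      (V := covDerivAlong (inducedMetric g F) id (fun _ => w) b) (W := fun _ => z) hx
      differentiableAt_id (differentiableAt_of_contDiffOn
        (hG.contDiffOn_covDerivAlong hG.isOpen contDiffOn_id (Set.mapsTo_id U)
          contDiffOn_const b) hG.isOpen hx) (differentiableAt_const _) a
    have h2 := hF.metric.fderiv_apply_apply (F := F)
      (V := covDerivAlong g F (fun y => fderiv ℝ F y w) b) (W := fun y => fderiv ℝ F y z)
      (hF.mapsTo hx) (hF.differentiableAt hx)
      (differentiableAt_of_contDiffOn (hF.contDiffOn_covDerivAlong (hFc w) b) hF.isOpen hx)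
      (differentiableAt_of_contDiffOn (hFc z) hF.isOpen hx) a
    have h3 : ∀ b w, covDerivAlong (inducedMetric g F) id (fun _ => w) b x =
        christoffel (inducedMetric g F) x b w := by
      intro b w
      simp [covDerivAlong]
    simp only [id] at h1
    rw [← he.fderiv_eq, h1, h3, h3] at h2
    rw [secondFundCoord, secondFundCoord, hF.apply_normalProj_normalProj hx,
      hF.tangentCoord_covDerivAlong_fderiv hx, hF.tangentCoord_covDerivAlong_fderiv hx]
    linarith
  rw [riemannCoord, map_sub, sub_apply, key, key,
    ← hF.metric.covDerivAlong_comm hF.isOpen hF.contDiffOn (hFc w) hx (hF.mapsTo hx), map_sub,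
    sub_apply]
  ring

/-- The Ricci equation. -/
theorem ricci (hF : IsImmersionOn g F U U') (hx : x ∈ U) {ι : Type*} [Fintype ι] (e : ι → E)
    (he : ∀ s, s = ∑ k, inducedMetric g F x s (e k) • e k) (u v : E) (ξ η : E')
    (hξ : ∀ z, g (F x) (fderiv ℝ F x z) ξ = 0) (hη : ∀ z, g (F x) (fderiv ℝ F x z) η = 0) :
    g (F x) (normalCurvCoord g F x u v ξ) η =
      g (F x) (riemannCoord g (F x) (fderiv ℝ F x u) (fderiv ℝ F x v) ξ) η +
      ∑ k, (g (F x) (secondFundCoord g F x v (e k)) ξ * g (F x) (secondFundCoord g F x u (e k)) η -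
        g (F x) (secondFundCoord g F x u (e k)) ξ * g (F x) (secondFundCoord g F x v (e k)) η) := by
  set V : E → E' := fun y => normalProj g F y ξ with hVdef
  have hVx : V x = ξ := hF.normalProj_of_normal hx ξ hξ
  have hV : ContDiffOn ℝ ∞ V U := hF.contDiffOn_normalProj contDiffOn_const
  have hVd := differentiableAt_of_contDiffOn hV hF.isOpen hx
  have hFc : ∀ v, ContDiffOn ℝ ∞ (fun y => fderiv ℝ F y v) U := fun v =>
    contDiffOn_fderiv_apply hF.contDiffOn hF.isOpen v
  have hII : ∀ a s ζ, (∀ z, g (F x) (fderiv ℝ F x z) ζ = 0) →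
      g (F x) (secondFundCoord g F x a s) ζ = g (F x) (fderiv ℝ (fderiv ℝ F) x a s +
        christoffelL g (F x) (fderiv ℝ F x a) (fderiv ℝ F x s)) ζ := fun a s ζ hζ => by
    rw [secondFundCoord, apply_normalProj_of_normal _ _ hζ, hF.covDerivAlong_fderiv_eq hx]
  -- Weingarten's relation: differentiate the identity ⟨V, dF e_k⟩ = 0.
  have hS : ∀ b k, inducedMetric g F x (tangentCoord g F x (covDerivAlong g F V b x)) (e k) =
      -g (F x) (secondFundCoord g F x b (e k)) ξ := by
    intro b k
    rw [hF.apply_tangentCoord hx]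
    have h0 : (fun y => g (F y) (V y) (fderiv ℝ F y (e k))) =ᶠ[nhds x] fun _ => (0 : ℝ) := by
      filter_upwards [hF.isOpen.mem_nhds hx] with y hy using hF.apply_normalProj_fderiv hy _ _
    have h1 := hF.metric.fderiv_apply_apply (F := F) (V := V) (W := fun y => fderiv ℝ F y (e k))
      (hF.mapsTo hx) (hF.differentiableAt hx) hVd
      (differentiableAt_of_contDiffOn (hFc (e k)) hF.isOpen hx) b
    rw [h0.fderiv_eq, fderiv_fun_const, hVx] at h1
    rw [secondFundCoord, apply_normalProj_of_normal _ _ hξ,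
      hF.metric.symm _ (hF.mapsTo hx) _ ξ]
    simp only [Pi.zero_apply, zero_apply] at h1
    linarith
  have key : ∀ a b, g (F x) (normalCovDeriv g F (normalCovDeriv g F V b) a x) η =
      g (F x) (covDerivAlong g F (covDerivAlong g F V b) a x) η +
      ∑ k, g (F x) (secondFundCoord g F x b (e k)) ξ *
        g (F x) (secondFundCoord g F x a (e k)) η := by
    intro a b
    have hD := hF.contDiffOn_covDerivAlong hV b
    have hDd := differentiableAt_of_contDiffOn hD hF.isOpen hx
    have hSd := differentiableAt_of_contDiffOn (hF.contDiffOn_tangentCoord hD) hF.isOpen hx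
    have hFd := differentiableAt_of_contDiffOn hF.contDiffOn_fderiv hF.isOpen hx
    set S : E → E := fun y => tangentCoord g F y (covDerivAlong g F V b y) with hSdef
    have h1 : normalCovDeriv g F V b = fun y => covDerivAlong g F V b y - fderiv ℝ F y (S y) := rfl
    -- The product rule applied to dF(S) produces a second-fundamental-form term in S and the
    -- tangent vector dF(∂_a S). The latter disappears when paired with the normal vector `η`.
    have h2 : covDerivAlong g F (normalCovDeriv g F V b) a x =
        covDerivAlong g F (covDerivAlong g F V b) a x -
        (fderiv ℝ (fderiv ℝ F) x a (S x) +
          christoffelL g (F x) (fderiv ℝ F x a) (fderiv ℝ F x (S x))) -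
          fderiv ℝ F x (fderiv ℝ S x a) := by
      change fderiv ℝ (normalCovDeriv g F V b) x a +
        christoffelL g (F x) (fderiv ℝ F x a) (normalCovDeriv g F V b x) =
        (fderiv ℝ (covDerivAlong g F V b) x a +
        christoffelL g (F x) (fderiv ℝ F x a) (covDerivAlong g F V b x)) - _ - _
      rw [h1, fderiv_fun_sub hDd (hFd.clm_apply hSd), fderiv_clm_apply hFd hSd]
      simp only [sub_apply, add_apply, ContinuousLinearMap.comp_apply,
        ContinuousLinearMap.flip_apply, map_sub]
      abel
    have h3 : S x = ∑ k, (-g (F x) (secondFundCoord g F x b (e k)) ξ) • e k := by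
      rw [he (S x)]
      exact Finset.sum_congr rfl fun k _ => by rw [hS b k]
    rw [normalCovDeriv, apply_normalProj_of_normal _ _ hη, h2, map_sub, map_sub, sub_apply,
      sub_apply, hη, sub_zero, h3]
    simp only [hII a _ η hη]
    simp only [map_sum, map_smul, neg_smul, map_neg, Finset.sum_neg_distrib, map_add, sum_apply,
      add_apply, smul_apply, smul_eq_mul, neg_apply, mul_add, Finset.sum_add_distrib]
    ring
  change g (F x) (normalCovDeriv g F (normalCovDeriv g F V v) u x -
    normalCovDeriv g F (normalCovDeriv g F V u) v x) η = _
  rw [map_sub, sub_apply, key, key, Finset.sum_sub_distrib, ← hVx,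
    ← hF.metric.covDerivAlong_comm hF.isOpen hF.contDiffOn hV hx (hF.mapsTo hx), map_sub,
    sub_apply]
  ring

end IsImmersionOn

end Coordinates

/-! ### Metrics in the preferred charts. -/

section Manifold

variable {k : ℕ} {M : Type*} [TopologicalSpace M] [ChartedSpace (EuclideanSpace ℝ (Fin k)) M]
  [IsManifold (𝓡 k) ∞ M]

theorem isManifold_one : IsManifold (𝓡 k) 1 M := IsManifold.of_le (n := ∞) (by simp)

theorem mfderiv_extChartAt_dChartSymm (p : M) {x : EuclideanSpace ℝ (Fin k)}
    (hx : x ∈ (extChartAt (𝓡 k) p).target) (u : EuclideanSpace ℝ (Fin k)) :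
    mfderiv (𝓡 k) 𝓘(ℝ, EuclideanSpace ℝ (Fin k)) (extChartAt (𝓡 k) p)
      ((extChartAt (𝓡 k) p).symm x) (dChartSymm p x u) = u := by
  have := isManifold_one (k := k) (M := M)
  have h := mfderiv_extChartAt_comp_mfderivWithin_extChartAt_symm (I := 𝓡 k) (x := p) hx
  rw [ModelWithCorners.range_eq_univ, mfderivWithin_univ] at h
  exact congrArg (fun L => L u) h

theorem dChartSymm_mfderiv_extChartAt (p : M) {x : EuclideanSpace ℝ (Fin k)}
    (hx : x ∈ (extChartAt (𝓡 k) p).target) (u : TangentSpace (𝓡 k) ((extChartAt (𝓡 k) p).symm x)) :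
    dChartSymm p x (mfderiv (𝓡 k) 𝓘(ℝ, EuclideanSpace ℝ (Fin k)) (extChartAt (𝓡 k) p)
      ((extChartAt (𝓡 k) p).symm x) u) = u := by
  have := isManifold_one (k := k) (M := M)
  have h := mfderivWithin_extChartAt_symm_comp_mfderiv_extChartAt (I := 𝓡 k) (x := p) hx
  rw [ModelWithCorners.range_eq_univ, mfderivWithin_univ] at h
  exact congrArg (fun L => L u) h

/-- The metric in a chart, on vectors that come from the manifold. -/
theorem metricInChart_mfderiv (g : SmoothMetric k M) (p : M) {q : M}
    (hq : q ∈ (extChartAt (𝓡 k) p).source) (u v : TangentSpace (𝓡 k) q) :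
    metricInChart g p (extChartAt (𝓡 k) p q)
      (mfderiv (𝓡 k) 𝓘(ℝ, EuclideanSpace ℝ (Fin k)) (extChartAt (𝓡 k) p) q u)
      (mfderiv (𝓡 k) 𝓘(ℝ, EuclideanSpace ℝ (Fin k)) (extChartAt (𝓡 k) p) q v) =
      g.inner q u v := by
  -- The point `q` stays a variable tied to `x` by an equation, so that substitution identifies the
  -- tangent spaces without casts.
  have key : ∀ x ∈ (extChartAt (𝓡 k) p).target, ∀ q, q = (extChartAt (𝓡 k) p).symm x →
      ∀ u v : TangentSpace (𝓡 k) q, metricInChart g p x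
      (mfderiv (𝓡 k) 𝓘(ℝ, EuclideanSpace ℝ (Fin k)) (extChartAt (𝓡 k) p) q u)
      (mfderiv (𝓡 k) 𝓘(ℝ, EuclideanSpace ℝ (Fin k)) (extChartAt (𝓡 k) p) q v) =
      g.inner q u v := by
    rintro x hx q rfl u v
    exact congrArg₂ (fun a b => g.inner ((extChartAt (𝓡 k) p).symm x) a b)
      (dChartSymm_mfderiv_extChartAt p hx u) (dChartSymm_mfderiv_extChartAt p hx v)
  exact key _ ((extChartAt (𝓡 k) p).map_source hq) q ((extChartAt (𝓡 k) p).left_inv hq).symm u v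

theorem metricInChart_coord (g : SmoothMetric k M) (p : M) (u v : TangentSpace (𝓡 k) p) :
    metricInChart g p (extChartAt (𝓡 k) p p) (coord p u) (coord p v) = g.inner p u v :=
  metricInChart_mfderiv g p (mem_extChartAt_source p) u v

/-- A tangent space is the model space as a type, and the preferred chart at `p` has identity
differential at `p` itself. Hence `coord p` can be inserted or removed freely. -/
theorem coord_apply_eq (p : M) (u : EuclideanSpace ℝ (Fin k)) : coord (k := k) p u = u := by
  have := isManifold_one (k := k) (M := M)
  exact congrArg (fun L => L u) (mfderiv_extChartAt_self (I := 𝓡 k) (x := p))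

/-- The tangent map of the inverse chart, composed with a constant field, is smooth. Smoothness of
the metric coefficients follows from this. -/
theorem contMDiffOn_dChartSymm (p : M) (u : EuclideanSpace ℝ (Fin k)) :
    ContMDiffOn 𝓘(ℝ, EuclideanSpace ℝ (Fin k)) (𝓡 k).tangent ∞
      (fun x => (⟨(extChartAt (𝓡 k) p).symm x, dChartSymm p x u⟩ : TangentBundle (𝓡 k) M))
      (extChartAt (𝓡 k) p).target := by
  have ho := isOpen_extChartAt_target (I := 𝓡 k) p
  have h1 : ContMDiffOn 𝓘(ℝ, EuclideanSpace ℝ (Fin k)).tangent (𝓡 k).tangent ∞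
      (tangentMapWithin 𝓘(ℝ, EuclideanSpace ℝ (Fin k)) (𝓡 k) (extChartAt (𝓡 k) p).symm
        (extChartAt (𝓡 k) p).target) _ :=
    (contMDiffOn_extChartAt_symm (I := 𝓡 k) (n := ∞) p).contMDiffOn_tangentMapWithin (by simp)
      ho.uniqueMDiffOn
  have h2 : ContMDiff 𝓘(ℝ, EuclideanSpace ℝ (Fin k)) 𝓘(ℝ, EuclideanSpace ℝ (Fin k)).tangent ∞
      (fun x => (⟨x, u⟩ : TangentBundle 𝓘(ℝ, EuclideanSpace ℝ (Fin k))
        (EuclideanSpace ℝ (Fin k)))) :=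
    contMDiff_vectorSpace_iff_contDiff.2 (contDiff_const (c := u))
  refine (h1.comp h2.contMDiffOn fun x hx => hx).congr fun x hx => ?_
  simp only [Function.comp_apply, tangentMapWithin, mfderivWithin_of_isOpen ho hx]
  rfl

/-- The metric in a chart is a metric on the chart domain. -/
theorem isMetricOn_metricInChart (g : SmoothMetric k M) (p : M) :
    IsMetricOn (metricInChart g p) (extChartAt (𝓡 k) p).target where
  isOpen := isOpen_extChartAt_target p
  contDiffOn := by
    refine contDiffOn_clm_apply.2 fun v => contDiffOn_clm_apply.2 fun w => ?_
    rw [← contMDiffOn_iff_contDiffOn]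
    intro x hx
    have hv := contMDiffOn_dChartSymm (M := M) p v x hx
    have hw := contMDiffOn_dChartSymm (M := M) p w x hx
    have hb := contMDiffOn_extChartAt_symm (I := 𝓡 k) (n := ∞) p x hx
    have : ContMDiffWithinAt 𝓘(ℝ, EuclideanSpace ℝ (Fin k)) ((𝓡 k).prod 𝓘(ℝ)) ∞
        (fun m => Bundle.TotalSpace.mk' ℝ (E := Bundle.Trivial M ℝ) ((extChartAt (𝓡 k) p).symm m)
          (g.inner ((extChartAt (𝓡 k) p).symm m) (dChartSymm p m v) (dChartSymm p m w)))
        (extChartAt (𝓡 k) p).target x := by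
      apply ContMDiffWithinAt.clm_bundle_apply₂ (F₁ := EuclideanSpace ℝ (Fin k))
        (F₂ := EuclideanSpace ℝ (Fin k))
      · exact ContMDiffAt.comp_contMDiffWithinAt x g.contMDiff.contMDiffAt hb
      · exact hv
      · exact hw
    simp only [Bundle.contMDiffWithinAt_totalSpace] at this
    exact this.2
  symm x _ v w := g.symm _ _ _
  pos x hx v hv := g.pos _ _ fun h0 => hv (by
    have h1 := mfderiv_extChartAt_dChartSymm p hx v
    rw [h0, map_zero] at h1
    exact h1.symm)

end Manifold

/-! ### Isometric immersions written in charts. -/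

section Submanifold

variable {n l : ℕ} {M N : Type*} [TopologicalSpace M] [ChartedSpace (EuclideanSpace ℝ (Fin n)) M]
  [IsManifold (𝓡 n) ∞ M] [TopologicalSpace N] [ChartedSpace (EuclideanSpace ℝ (Fin l)) N]
  [IsManifold (𝓡 l) ∞ N] {g : SmoothMetric n M} {h : SmoothMetric l N} {f : M → N}

/-- The coordinate domain at `p` that `f` maps into the chart domain at `f p`. -/
def chartDomain (n l : ℕ) {M N : Type*} [TopologicalSpace M]
    [ChartedSpace (EuclideanSpace ℝ (Fin n)) M] [TopologicalSpace N]
    [ChartedSpace (EuclideanSpace ℝ (Fin l)) N] (f : M → N) (p : M) :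
    Set (EuclideanSpace ℝ (Fin n)) :=
  (extChartAt (𝓡 n) p).target ∩
    (extChartAt (𝓡 n) p).symm ⁻¹' (f ⁻¹' (extChartAt (𝓡 l) (f p)).source)

theorem mem_chartDomain (f : M → N) (p : M) : extChartAt (𝓡 n) p p ∈ chartDomain n l f p := by
  refine ⟨mem_extChartAt_target p, ?_⟩
  simp only [Set.mem_preimage, extChartAt_to_inv]
  exact mem_extChartAt_source (f p)

theorem writtenInExtChartAt_self (f : M → N) (p : M) :
    writtenInExtChartAt (𝓡 n) (𝓡 l) p f (extChartAt (𝓡 n) p p) = extChartAt (𝓡 l) (f p) (f p) := by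
  simp [writtenInExtChartAt]

theorem isOpen_chartDomain (hf : Continuous f) (p : M) : IsOpen (chartDomain n l f p) :=
  (continuousOn_extChartAt_symm p).isOpen_inter_preimage (isOpen_extChartAt_target p)
    ((isOpen_extChartAt_source (f p)).preimage hf)

namespace IsIsometricImmersion

theorem contDiffOn_written (hf : IsIsometricImmersion g h f) (p : M) :
    ContDiffOn ℝ ∞ (writtenInExtChartAt (𝓡 n) (𝓡 l) p f) (chartDomain n l f p) := by
  rw [← contMDiffOn_iff_contDiffOn]
  have h1 : ContMDiffOn 𝓘(ℝ, EuclideanSpace ℝ (Fin n)) (𝓡 l) ∞ (f ∘ (extChartAt (𝓡 n) p).symm)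
      (chartDomain n l f p) :=
    hf.1.comp_contMDiffOn ((contMDiffOn_extChartAt_symm p).mono Set.inter_subset_left)
  exact (contMDiffOn_extChartAt (I := 𝓡 l) (n := ∞) (x := f p)).comp h1
    fun x hx => by simpa [extChartAt_source] using hx.2

theorem fderiv_written (hf : IsIsometricImmersion g h f) (p : M) {x : EuclideanSpace ℝ (Fin n)}
    (hx : x ∈ chartDomain n l f p) (u : EuclideanSpace ℝ (Fin n)) :
    fderiv ℝ (writtenInExtChartAt (𝓡 n) (𝓡 l) p f) x u =
      mfderiv (𝓡 l) 𝓘(ℝ, EuclideanSpace ℝ (Fin l)) (extChartAt (𝓡 l) (f p))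
        (f ((extChartAt (𝓡 n) p).symm x))
        (mfderiv (𝓡 n) (𝓡 l) f ((extChartAt (𝓡 n) p).symm x) (dChartSymm p x u)) := by
  have := isManifold_one (k := n) (M := M)
  have := isManifold_one (k := l) (M := N)
  have h1 : MDifferentiableAt 𝓘(ℝ, EuclideanSpace ℝ (Fin n)) (𝓡 n) (extChartAt (𝓡 n) p).symm x :=
    ((contMDiffOn_extChartAt_symm (I := 𝓡 n) (n := ∞) p).contMDiffAt
      ((isOpen_extChartAt_target p).mem_nhds hx.1)).mdifferentiableAt (by simp)
  have h2 : MDifferentiableAt (𝓡 n) (𝓡 l) f ((extChartAt (𝓡 n) p).symm x) :=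
    hf.1.contMDiffAt.mdifferentiableAt (by simp)
  have h3 : MDifferentiableAt (𝓡 l) 𝓘(ℝ, EuclideanSpace ℝ (Fin l)) (extChartAt (𝓡 l) (f p))
      (f ((extChartAt (𝓡 n) p).symm x)) :=
    mdifferentiableAt_extChartAt (by simpa [extChartAt_source] using hx.2)
  rw [← mfderiv_eq_fderiv]
  have h4 := mfderiv_comp x h3 (h2.comp x h1)
  rw [mfderiv_comp x h2 h1] at h4
  exact congrArg (fun L => L u) h4

theorem metricInChart_fderiv (hf : IsIsometricImmersion g h f) (p : M)
    {x : EuclideanSpace ℝ (Fin n)} (hx : x ∈ chartDomain n l f p)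
    (u v : EuclideanSpace ℝ (Fin n)) :
    metricInChart h (f p) (writtenInExtChartAt (𝓡 n) (𝓡 l) p f x)
      (fderiv ℝ (writtenInExtChartAt (𝓡 n) (𝓡 l) p f) x u)
      (fderiv ℝ (writtenInExtChartAt (𝓡 n) (𝓡 l) p f) x v) = metricInChart g p x u v := by
  rw [hf.fderiv_written p hx, hf.fderiv_written p hx]
  exact (metricInChart_mfderiv h (f p) hx.2 _ _).trans (hf.2 _ _ _)

/-- Injectivity of the differential comes from the isometry condition: a vector with zero image has
zero length. -/
theorem isImmersionOn (hf : IsIsometricImmersion g h f) (p : M) :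
    IsImmersionOn (metricInChart h (f p)) (writtenInExtChartAt (𝓡 n) (𝓡 l) p f)
      (chartDomain n l f p) (extChartAt (𝓡 l) (f p)).target where
  metric := isMetricOn_metricInChart h (f p)
  isOpen := isOpen_chartDomain hf.1.continuous p
  contDiffOn := hf.contDiffOn_written p
  mapsTo x hx := (extChartAt (𝓡 l) (f p)).map_source hx.2
  injective x hx := by
    rw [injective_iff_map_eq_zero]
    intro u hu
    by_contra hne
    have h1 := (isMetricOn_metricInChart g p).pos x hx.1 u hne
    rw [← hf.metricInChart_fderiv p hx, hu, map_zero] at h1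
    exact lt_irrefl _ h1

/-- Equality on a neighbourhood, and not only at the point, is needed to identify the curvature of
the induced metric with that of `g`. -/
theorem inducedMetric_eventuallyEq (hf : IsIsometricImmersion g h f) (p : M) :
    inducedMetric (metricInChart h (f p)) (writtenInExtChartAt (𝓡 n) (𝓡 l) p f)
      =ᶠ[nhds (extChartAt (𝓡 n) p p)] metricInChart g p := by
  filter_upwards [(isOpen_chartDomain (n := n) (l := l) hf.1.continuous p).mem_nhds
    (mem_chartDomain f p)] with x hx
  ext u v
  exact hf.metricInChart_fderiv p hx u v

theorem fderiv_written_coord (hf : IsIsometricImmersion g h f) (p : M) (u : TangentSpace (𝓡 n) p) :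
    fderiv ℝ (writtenInExtChartAt (𝓡 n) (𝓡 l) p f) (extChartAt (𝓡 n) p p) (coord p u) =
      coord (f p) (mfderiv (𝓡 n) (𝓡 l) f p u) := by
  have h1 : MDifferentiableAt (𝓡 n) (𝓡 l) f p := hf.1.contMDiffAt.mdifferentiableAt (by simp)
  have h2 : fderiv ℝ (writtenInExtChartAt (𝓡 n) (𝓡 l) p f) (extChartAt (𝓡 n) p p) =
      mfderiv (𝓡 n) (𝓡 l) f p := by
    rw [h1.mfderiv, ModelWithCorners.range_eq_univ, fderivWithin_univ]
  rw [show coord (f p) (mfderiv (𝓡 n) (𝓡 l) f p u) = mfderiv (𝓡 n) (𝓡 l) f p u from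
    coord_apply_eq (f p) _, h2]
  exact congrArg _ (coord_apply_eq p u)

end IsIsometricImmersion

end Submanifold

theorem IsOrthonormalFor.apply_eq_repr {V ι : Type*} [AddCommGroup V] [Module ℝ V] [Fintype ι]
    {B : V →ₗ[ℝ] V →ₗ[ℝ] ℝ} {e : Module.Basis ι ℝ V}
    (he : IsOrthonormalFor (fun v w => B v w) e) (v : V) (i : ι) : B v (e i) = e.repr v i := by
  conv_lhs => rw [← e.sum_repr v]
  rw [map_sum, LinearMap.sum_apply, Finset.sum_eq_single i]
  · simp [he.1 i]
  · intro j _ hj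
    simp [he.2 j i hj]
  · simp

theorem IsOrthonormalFor.sum_smul_eq {V ι : Type*} [AddCommGroup V] [Module ℝ V] [Fintype ι]
    {B : V →ₗ[ℝ] V →ₗ[ℝ] ℝ} {e : Module.Basis ι ℝ V}
    (he : IsOrthonormalFor (fun v w => B v w) e) (v : V) : v = ∑ i, B v (e i) • e i := by
  conv_lhs => rw [← e.sum_repr v]
  simp only [he.apply_eq_repr]

theorem IsOrthonormalFor.apply_eq_sum {V ι : Type*} [AddCommGroup V] [Module ℝ V] [Fintype ι]
    {B : V →ₗ[ℝ] V →ₗ[ℝ] ℝ} {e : Module.Basis ι ℝ V}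
    (he : IsOrthonormalFor (fun v w => B v w) e) (v w : V) :
    B v w = ∑ i, B v (e i) * B w (e i) := by
  conv_lhs => rw [he.sum_smul_eq w]
  simp only [map_sum, map_smul, smul_eq_mul]
  exact Finset.sum_congr rfl fun i _ => mul_comm _ _

/-! ### Gauss and Ricci equations in a space form. -/

section Submanifold

variable {n l : ℕ} {M N : Type*} [TopologicalSpace M] [ChartedSpace (EuclideanSpace ℝ (Fin n)) M]
  [IsManifold (𝓡 n) ∞ M] [TopologicalSpace N] [ChartedSpace (EuclideanSpace ℝ (Fin l)) N]
  [IsManifold (𝓡 l) ∞ N] {g : SmoothMetric n M} {h : SmoothMetric l N} {f : M → N}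

/-- In a space of constant curvature, the curvature tensor in a chart is determined. -/
theorem HasConstantCurvature.apply_riemannCoord {κ : ℝ} (hN : HasConstantCurvature h κ) (q : N)
    (u v w z : EuclideanSpace ℝ (Fin l)) :
    metricInChart h q (extChartAt (𝓡 l) q q)
      (riemannCoord (metricInChart h q) (extChartAt (𝓡 l) q q) u v w) z =
    κ * (metricInChart h q (extChartAt (𝓡 l) q q) u z * metricInChart h q (extChartAt (𝓡 l) q q) v w
      - metricInChart h q (extChartAt (𝓡 l) q q) u w *
        metricInChart h q (extChartAt (𝓡 l) q q) v z) := by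
  have hm := isMetricOn_metricInChart h q
  have hx : extChartAt (𝓡 l) q q ∈ (extChartAt (𝓡 l) q).target := mem_extChartAt_target q
  refine hm.apply_riemannCoord_of_sectional hx (fun a b hab => ?_) u v w z
  have key : riemann h q a b b a /
      (h.inner q a a * h.inner q b b - h.inner q a b ^ 2) = κ := hN q a b hab
  have hc : ∀ a b : EuclideanSpace ℝ (Fin l), h.inner q a b =
      metricInChart h q (extChartAt (𝓡 l) q q) a b := fun a b => by
    have := metricInChart_coord h q a b
    rw [coord_apply_eq, coord_apply_eq] at this
    exact this.symm
  have hr : riemann h q a b b a = metricInChart h q (extChartAt (𝓡 l) q q)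
      (riemannCoord (metricInChart h q) (extChartAt (𝓡 l) q q) a b b) a := by
    change metricInChart h q (extChartAt (𝓡 l) q q) (riemannCoord (metricInChart h q)
      (extChartAt (𝓡 l) q q) (coord q a) (coord q b) (coord q b)) (coord q a) = _
    rw [coord_apply_eq, coord_apply_eq]
  rw [hr, hc, hc, hc] at key
  set B := metricInChart h q (extChartAt (𝓡 l) q q) with hB
  have ha : a ≠ 0 := hab.ne_zero 0
  -- This vector is B(a,a) times the component of `b` orthogonal to `a`. Its squared length is
  -- B(a,a) times the Gram determinant, so the denominator of the sectional curvature is nonzero.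
  have hw : B a a • b - B a b • a ≠ 0 := fun h0 => by
    have h1 := LinearIndependent.pair_iff.1 hab (-B a b) (B a a) (by rw [← h0]; module)
    exact (hm.pos _ hx a ha).ne' h1.2
  have hpos := hm.pos _ hx _ hw
  have hden : B a a * B b b - B a b ^ 2 ≠ 0 := fun h0 => by
    have h2 : B (B a a • b - B a b • a) (B a a • b - B a b • a) =
        B a a * (B a a * B b b - B a b ^ 2) := by
      simp only [map_sub, map_smul, sub_apply, smul_apply, smul_eq_mul,
        show B b a = B a b from hm.symm _ hx b a]
      ring
    rw [← hB, h2, h0, mul_zero] at hpos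
    exact lt_irrefl _ hpos
  rw [div_eq_iff hden] at key
  exact key

namespace IsIsometricImmersion

theorem coord_normal (hf : IsIsometricImmersion g h f) (p : M) (ξ : normalSpace (n := n) h f p)
    (z : EuclideanSpace ℝ (Fin n)) :
    metricInChart h (f p) (writtenInExtChartAt (𝓡 n) (𝓡 l) p f (extChartAt (𝓡 n) p p))
      (fderiv ℝ (writtenInExtChartAt (𝓡 n) (𝓡 l) p f) (extChartAt (𝓡 n) p p) z)
      (coord (f p) ξ.1) = 0 := by
  have h1 := hf.fderiv_written_coord p z
  rw [coord_apply_eq] at h1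
  rw [writtenInExtChartAt_self, h1, metricInChart_coord]
  exact ξ.2 z

/-- The second fundamental form is trilinear. -/
theorem exists_secondFund_eq (hf : IsIsometricImmersion g h f) (p : M) :
    ∃ L : normalSpace (n := n) h f p →ₗ[ℝ] TangentSpace (𝓡 n) p →ₗ[ℝ] TangentSpace (𝓡 n) p →ₗ[ℝ] ℝ,
      ∀ ξ u v, secondFund h f p ξ u v = L ξ u v := by
  have hI := hf.isImmersionOn p
  have hx := mem_chartDomain (n := n) (l := l) f p
  set F := writtenInExtChartAt (𝓡 n) (𝓡 l) p f with hF
  set x := extChartAt (𝓡 n) p p with hxdef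
  set B := metricInChart h (f p) (F x) with hB
  -- Against a normal vector the projection in II may be dropped, which leaves D²F + Γ(dF, dF),
  -- visibly bilinear.
  let Φ : EuclideanSpace ℝ (Fin n) →L[ℝ] EuclideanSpace ℝ (Fin n) →L[ℝ] EuclideanSpace ℝ (Fin l) :=
    fderiv ℝ (fderiv ℝ F) x +
      (christoffelL (metricInChart h (f p)) (F x)).bilinearComp (fderiv ℝ F x) (fderiv ℝ F x)
  let L : normalSpace (n := n) h f p → TangentSpace (𝓡 n) p →ₗ[ℝ] TangentSpace (𝓡 n) p →ₗ[ℝ] ℝ :=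
    fun ξ => LinearMap.mk₂ ℝ (fun u v => B (Φ (coord p u) (coord p v)) (coord (f p) ξ.1))
      (fun a b c => by simp only [map_add, add_apply])
      (fun c a b => by simp only [map_smul, smul_apply])
      (fun a b c => by simp only [map_add, add_apply])
      (fun c a b => by simp only [map_smul, smul_apply])
  refine ⟨{ toFun := L, map_add' := fun ξ η => ?_, map_smul' := fun c ξ => ?_ }, ?_⟩
  · refine LinearMap.ext₂ fun u v => ?_
    change B _ (coord (f p) (ξ.1 + η.1)) = B _ (coord (f p) ξ.1) + B _ (coord (f p) η.1)
    rw [map_add, map_add]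
  · refine LinearMap.ext₂ fun u v => ?_
    change B _ (coord (f p) (c • ξ.1)) = c * B _ (coord (f p) ξ.1)
    rw [map_smul, map_smul, smul_eq_mul]
  · intro ξ u v
    have h1 := hI.covDerivAlong_fderiv_eq hx (coord p u) (coord p v)
    have h2 := apply_normalProj_of_normal (covDerivAlong (metricInChart h (f p)) F
      (fun y => fderiv ℝ F y (coord p v)) (coord p u) x) (coord (f p) ξ.1) (hf.coord_normal p ξ)
    rw [h1] at h2
    rw [secondFund, ← writtenInExtChartAt_self (n := n) f p, secondFundCoord, h1]
    exact h2

end IsIsometricImmersion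

end Submanifold

section Submanifold

variable {n l : ℕ} {M N : Type*} [TopologicalSpace M] [ChartedSpace (EuclideanSpace ℝ (Fin n)) M]
  [IsManifold (𝓡 n) ∞ M] [TopologicalSpace N] [ChartedSpace (EuclideanSpace ℝ (Fin l)) N]
  [IsManifold (𝓡 l) ∞ N] {g : SmoothMetric n M} {h : SmoothMetric l N} {f : M → N}

namespace IsIsometricImmersion

theorem exists_coord_eq (hf : IsIsometricImmersion g h f) (p : M) (w : EuclideanSpace ℝ (Fin l))
    (hw : ∀ z, metricInChart h (f p) (extChartAt (𝓡 l) (f p) (f p))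
      (fderiv ℝ (writtenInExtChartAt (𝓡 n) (𝓡 l) p f) (extChartAt (𝓡 n) p p) z) w = 0) :
    ∃ η : normalSpace (n := n) h f p, coord (f p) η.1 = w := by
  refine ⟨⟨w, fun z => ?_⟩, coord_apply_eq _ _⟩
  have h1 := hw (coord p z)
  rw [hf.fderiv_written_coord, ← coord_apply_eq (f p) w] at h1
  exact (metricInChart_coord h (f p) _ _).symm.trans h1

/-- The values of II are normal, so products of them can be expanded in an orthonormal normal frame
in the Gauss equation. -/
theorem exists_coord_eq_secondFundCoord (hf : IsIsometricImmersion g h f) (p : M)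
    (a b : TangentSpace (𝓡 n) p) :
    ∃ η : normalSpace (n := n) h f p, coord (f p) η.1 =
      secondFundCoord (metricInChart h (f p)) (writtenInExtChartAt (𝓡 n) (𝓡 l) p f)
        (extChartAt (𝓡 n) p p) (coord p a) (coord p b) := by
  have hI := hf.isImmersionOn p
  have hx := mem_chartDomain (n := n) (l := l) f p
  refine hf.exists_coord_eq p _ fun z => ?_
  have h1 := hI.apply_normalProj_fderiv hx (covDerivAlong (metricInChart h (f p))
    (writtenInExtChartAt (𝓡 n) (𝓡 l) p f) (fun y => fderiv ℝ
      (writtenInExtChartAt (𝓡 n) (𝓡 l) p f) y (coord p b)) (coord p a)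
      (extChartAt (𝓡 n) p p)) z
  rw [hI.metric.symm _ (hI.mapsTo hx), writtenInExtChartAt_self] at h1
  exact h1

/-- The Gauss equation for submanifolds of a space form. -/
theorem riemann_eq (hf : IsIsometricImmersion g h f) {κ : ℝ} (hN : HasConstantCurvature h κ)
    (p : M) {ι : Type*} [Fintype ι] (ξ : Module.Basis ι ℝ (normalSpace (n := n) h f p))
    (hξ : IsOrthonormalFor (fun v w => h.inner (f p) v.1 w.1) ξ) (u v : TangentSpace (𝓡 n) p) :
    riemann g p u v v u = κ * (g.inner p u u * g.inner p v v - g.inner p u v ^ 2) +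
      ∑ r, (secondFund h f p (ξ r) u u * secondFund h f p (ξ r) v v -
        secondFund h f p (ξ r) u v * secondFund h f p (ξ r) v u) := by
  have hI := hf.isImmersionOn p
  have hx := mem_chartDomain (n := n) (l := l) f p
  have hsymm := hI.metric.symm _ (hI.mapsTo hx)
  have hnn : ∀ a b c d : TangentSpace (𝓡 n) p,
      metricInChart h (f p) (extChartAt (𝓡 l) (f p) (f p))
      (secondFundCoord (metricInChart h (f p)) (writtenInExtChartAt (𝓡 n) (𝓡 l) p f)
        (extChartAt (𝓡 n) p p) (coord p a) (coord p b))
      (secondFundCoord (metricInChart h (f p)) (writtenInExtChartAt (𝓡 n) (𝓡 l) p f)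
        (extChartAt (𝓡 n) p p) (coord p c) (coord p d)) =
      ∑ r, secondFund h f p (ξ r) a b * secondFund h f p (ξ r) c d := by
    intro a b c d
    obtain ⟨η, hη⟩ := hf.exists_coord_eq_secondFundCoord p a b
    obtain ⟨ζ, hζ⟩ := hf.exists_coord_eq_secondFundCoord p c d
    have h1 := IsOrthonormalFor.apply_eq_sum
      (B := (metricForm h (f p)).restrict (normalSpace (n := n) h f p)) hξ η ζ
    simp only [secondFund]
    rw [← hη, ← hζ]
    simp only [metricInChart_coord]
    exact h1
  have he := hf.inducedMetric_eventuallyEq p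
  have hgauss := hI.gauss hx (coord p u) (coord p v) (coord p v) (coord p u)
  rw [he.self_of_nhds, riemannCoord_congr he, writtenInExtChartAt_self,
    hN.apply_riemannCoord, hnn, hnn] at hgauss
  simp only [hf.fderiv_written_coord, metricInChart_coord] at hgauss
  simp only [hf.2] at hgauss
  rw [riemann, hgauss, Finset.sum_sub_distrib, g.symm p v u]
  simp only [mul_comm (secondFund h f p _ v v)]
  ring

/-- The Ricci equation for submanifolds of a space form. -/
theorem normalCurv_eq (hf : IsIsometricImmersion g h f) {κ : ℝ} (hN : HasConstantCurvature h κ)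
    (p : M) {ι : Type*} [Fintype ι] (e : Module.Basis ι ℝ (TangentSpace (𝓡 n) p))
    (he : IsOrthonormalFor (fun u v => g.inner p u v) e) (u v : TangentSpace (𝓡 n) p)
    (ξ η : normalSpace (n := n) h f p) :
    normalCurv h f p u v ξ η = ∑ k, (secondFund h f p ξ v (e k) * secondFund h f p η u (e k) -
      secondFund h f p ξ u (e k) * secondFund h f p η v (e k)) := by
  have hI := hf.isImmersionOn p
  have hx := mem_chartDomain (n := n) (l := l) f p
  have hsymm := hI.metric.symm _ (hI.mapsTo hx)
  have hexp : ∀ s : EuclideanSpace ℝ (Fin n), s = ∑ k, inducedMetric (metricInChart h (f p))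
      (writtenInExtChartAt (𝓡 n) (𝓡 l) p f) (extChartAt (𝓡 n) p p) s (coord p (e k)) •
        coord p (e k) := by
    intro s
    have h1 := congrArg (coord p) (IsOrthonormalFor.sum_smul_eq (B := metricForm g p) he s)
    rw [map_sum, coord_apply_eq] at h1
    refine h1.trans (Finset.sum_congr rfl fun k _ => ?_)
    rw [(hf.inducedMetric_eventuallyEq p).self_of_nhds, map_smul]
    have h2 := metricInChart_coord g p s (e k)
    rw [coord_apply_eq p s] at h2
    rw [h2]
    rfl
  have hricci := hI.ricci hx (fun k => coord p (e k)) hexp (coord p u) (coord p v)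
    (coord (f p) ξ.1) (coord (f p) η.1) (hf.coord_normal p ξ) (hf.coord_normal p η)
  have h0 : ∀ z (ζ : normalSpace (n := n) h f p),
      metricInChart h (f p) (extChartAt (𝓡 l) (f p) (f p))
      (fderiv ℝ (writtenInExtChartAt (𝓡 n) (𝓡 l) p f) (extChartAt (𝓡 n) p p) z)
      (coord (f p) ζ.1) = 0 := fun z ζ => by
    rw [← writtenInExtChartAt_self (n := n) f p]
    exact hf.coord_normal p ζ z
  -- The ambient curvature term pairs tangent with normal vectors only, hence vanishes.
  rw [writtenInExtChartAt_self, hN.apply_riemannCoord, h0, h0, h0] at hricci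
  rw [normalCurv, hricci]
  simp only [secondFund]
  ring

end IsIsometricImmersion

end Submanifold

/-! ### Independence of the orthonormal frame. -/

section OrthonormalBases

variable {V ι ι' : Type*} [AddCommGroup V] [Module ℝ V] [Fintype ι] [Fintype ι']
  {B : V →ₗ[ℝ] V →ₗ[ℝ] ℝ} {e : Module.Basis ι ℝ V} {e' : Module.Basis ι' ℝ V}

/-- The trace of a bilinear form does not depend on the orthonormal basis. -/
theorem IsOrthonormalFor.sum_apply_self_eq (hs : ∀ v w, B v w = B w v)
    (he : IsOrthonormalFor (fun v w => B v w) e) (he' : IsOrthonormalFor (fun v w => B v w) e')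
    (T : V →ₗ[ℝ] V →ₗ[ℝ] ℝ) : ∑ i, T (e i) (e i) = ∑ a, T (e' a) (e' a) := by
  have h1 : ∀ i, T (e i) (e i) = ∑ a, B (e i) (e' a) * T (e' a) (e i) := fun i => by
    have := congrArg (fun v => T v (e i)) (he'.sum_smul_eq (e i))
    simpa only [map_sum, map_smul, LinearMap.sum_apply, LinearMap.smul_apply, smul_eq_mul]
      using this
  have h2 : ∀ a, T (e' a) (e' a) = ∑ i, B (e i) (e' a) * T (e' a) (e i) := fun a => by
    have := congrArg (T (e' a)) (he.sum_smul_eq (e' a))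
    simpa only [map_sum, map_smul, smul_eq_mul, hs (e' a)] using this
  simp only [h1, h2]
  exact Finset.sum_comm

theorem IsOrthonormalFor.sum_mul_eq (hs : ∀ v w, B v w = B w v)
    (he : IsOrthonormalFor (fun v w => B v w) e) (he' : IsOrthonormalFor (fun v w => B v w) e')
    (φ ψ : V →ₗ[ℝ] ℝ) : ∑ i, φ (e i) * ψ (e i) = ∑ a, φ (e' a) * ψ (e' a) := by
  simpa using he.sum_apply_self_eq hs he' ((LinearMap.mul ℝ ℝ).compl₁₂ φ ψ)

/-- The inner product of bilinear forms does not depend on the orthonormal basis. -/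
theorem IsOrthonormalFor.sum_sum_mul_eq (hs : ∀ v w, B v w = B w v)
    (he : IsOrthonormalFor (fun v w => B v w) e) (he' : IsOrthonormalFor (fun v w => B v w) e')
    (S T : V →ₗ[ℝ] V →ₗ[ℝ] ℝ) :
    ∑ i, ∑ j, S (e i) (e j) * T (e i) (e j) = ∑ a, ∑ b, S (e' a) (e' b) * T (e' a) (e' b) := by
  simp only [he.sum_mul_eq hs he' (S _) (T _)]
  rw [Finset.sum_comm]
  conv_rhs => rw [Finset.sum_comm]
  exact Finset.sum_congr rfl fun b _ => he.sum_mul_eq hs he' (S.flip (e' b)) (T.flip (e' b))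

theorem IsOrthonormalFor.exists_basis [FiniteDimensional ℝ V] {v : ι → V}
    (hv : IsOrthonormalFor (fun v w => B v w) v) (hc : Fintype.card ι = Module.finrank ℝ V) :
    ∃ b : Module.Basis ι ℝ V, ⇑b = v := by
  have hli : LinearIndependent ℝ v := by
    rw [Fintype.linearIndependent_iff]
    intro c hc i
    have h1 := congrArg (fun x => B x (v i)) hc
    simp only [map_sum, map_smul, LinearMap.sum_apply, LinearMap.smul_apply, smul_eq_mul, map_zero,
      LinearMap.zero_apply] at h1
    rw [Finset.sum_eq_single i (fun j _ hj => mul_eq_zero_of_right _ (hv.2 j i hj))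
      (by simp)] at h1
    exact (mul_one _).symm.trans ((congrArg (c i * ·) (hv.1 i).symm).trans h1)
  exact ⟨Module.Basis.mk hli (hli.span_eq_top_of_card_eq_finrank' hc).ge, by simp⟩

/-- An orthogonal change of basis preserves orthonormality. -/
theorem IsOrthonormalFor.of_orthogonal [DecidableEq ι']
    (he : IsOrthonormalFor (fun v w => B v w) e) {P : Matrix ι ι' ℝ} (hP : P.transpose * P = 1) :
    IsOrthonormalFor (fun v w => B v w) fun i => ∑ a, P a i • e a := by
  classical
  have key : ∀ i j, B (∑ a, P a i • e a) (∑ a, P a j • e a) = (1 : Matrix ι' ι' ℝ) i j := by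
    intro i j
    rw [← hP, Matrix.mul_apply]
    simp only [map_sum, map_smul, LinearMap.sum_apply, LinearMap.smul_apply, smul_eq_mul,
      Matrix.transpose_apply]
    refine Finset.sum_congr rfl fun a _ => ?_
    rw [Finset.sum_eq_single a]
    · have : B (e a) (e a) = 1 := he.1 a
      rw [this, mul_one, mul_comm]
    · intro b _ hb
      have : B (e b) (e a) = 0 := he.2 b a hb
      rw [this, mul_zero]
    · simp
  exact ⟨fun i => (key i i).trans (Matrix.one_apply_eq i),
    fun i j hij => (key i j).trans (Matrix.one_apply_ne hij)⟩

/-- Passes from the sums over i < j in the curvature definitions to full double sums, for which the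
frame can be changed. -/
theorem sum_ite_lt_eq {N : ℕ} (T : Fin N → Fin N → ℝ) (hs : ∀ i j, T i j = T j i)
    (h0 : ∀ i, T i i = 0) :
    ∑ i, ∑ j, (if i < j then T i j else 0) = 1 / 2 * ∑ i, ∑ j, T i j := by
  have h1 : ∀ i j, T i j = (if i < j then T i j else 0) + (if j < i then T j i else 0) := by
    intro i j
    rcases lt_trichotomy i j with h | h | h
    · simp [h, h.asymm]
    · simp [h, h0]
    · simp [h, h.asymm, hs i j]
  have h2 : ∑ i, ∑ j, T i j = ∑ i, ∑ j, (if i < j then T i j else 0) +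
      ∑ i, ∑ j, (if j < i then T j i else 0) := by
    simp only [← Finset.sum_add_distrib]
    exact Finset.sum_congr rfl fun i _ => Finset.sum_congr rfl fun j _ => h1 i j
  rw [h2, Finset.sum_comm (f := fun i j => if j < i then T j i else 0)]
  ring

end OrthonormalBases

/-! ### Rank, trace and eigenvalues of positive semidefinite matrices. -/

section Matrices

open Matrix

/-- The spectral theorem, with the rank as the number of nonzero eigenvalues and the two traces as
power sums. -/
theorem exists_orthogonal_diagonalization {ι : Type*} [Fintype ι] [DecidableEq ι]
    {G : Matrix ι ι ℝ} (hG : G.PosSemidef) :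
    ∃ (U : Matrix ι ι ℝ) (μ : ι → ℝ), Uᵀ * U = 1 ∧ Uᵀ * G * U = diagonal μ ∧ (∀ i, 0 ≤ μ i) ∧
      Fintype.card {i // μ i ≠ 0} = G.rank ∧ G.trace = ∑ i, μ i ∧
      (G * G).trace = ∑ i, μ i ^ 2 := by
  set U : Matrix ι ι ℝ := hG.1.eigenvectorUnitary.1 with hU
  have hU1 : Uᵀ * U = 1 := by
    have := (Matrix.mem_unitaryGroup_iff'.1 hG.1.eigenvectorUnitary.2)
    rwa [Matrix.star_eq_conjTranspose, Matrix.conjTranspose_eq_transpose_of_trivial] at this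
  have hU2 : U * Uᵀ = 1 := mul_eq_one_comm.1 hU1
  have hsp : G = U * diagonal hG.1.eigenvalues * Uᵀ := by
    have := hG.1.spectral_theorem
    rw [Unitary.conjStarAlgAut_apply, Matrix.star_eq_conjTranspose, Matrix.conjTranspose_eq_transpose_of_trivial] at this
    exact this
  have hd : Uᵀ * G * U = diagonal hG.1.eigenvalues := by
    conv_lhs => rw [hsp]
    calc Uᵀ * (U * diagonal hG.1.eigenvalues * Uᵀ) * U
        = (Uᵀ * U) * diagonal hG.1.eigenvalues * (Uᵀ * U) := by simp only [Matrix.mul_assoc]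
      _ = _ := by rw [hU1, Matrix.one_mul, Matrix.mul_one]
  refine ⟨U, hG.1.eigenvalues, hU1, hd, hG.eigenvalues_nonneg,
    hG.1.rank_eq_card_non_zero_eigs.symm, ?_, ?_⟩
  · rw [← Matrix.trace_diagonal, ← hd, Matrix.trace_mul_comm, ← Matrix.mul_assoc, hU2,
      Matrix.one_mul]
  · have h1 : diagonal hG.1.eigenvalues * diagonal hG.1.eigenvalues = Uᵀ * (G * G) * U := by
      rw [← hd]
      calc Uᵀ * G * U * (Uᵀ * G * U) = Uᵀ * G * (U * Uᵀ) * G * U := by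
            simp only [Matrix.mul_assoc]
        _ = _ := by rw [hU2, Matrix.mul_one]; simp only [Matrix.mul_assoc]
    have h2 : (diagonal hG.1.eigenvalues * diagonal hG.1.eigenvalues).trace =
        ∑ i, hG.1.eigenvalues i ^ 2 := by
      rw [Matrix.diagonal_mul_diagonal, Matrix.trace_diagonal]
      simp only [sq]
    rw [← h2, h1, Matrix.trace_mul_comm (Uᵀ * (G * G)), ← Matrix.mul_assoc, hU2, Matrix.one_mul]

/-- Cauchy–Schwarz restricted to the nonzero eigenvalues, so that the rank replaces the size of the
matrix. -/
theorem sq_trace_le_rank_mul {ι : Type*} [Fintype ι] [DecidableEq ι] {G : Matrix ι ι ℝ}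
    (hG : G.PosSemidef) : G.trace ^ 2 ≤ G.rank * (G * G).trace := by
  obtain ⟨-, μ, -, -, -, hr, h1, h2⟩ := exists_orthogonal_diagonalization hG
  rw [h1, h2, ← hr, Fintype.card_subtype, ← Finset.sum_filter_ne_zero,
    ← Finset.sum_filter_of_ne (p := fun i => μ i ≠ 0) (f := fun i => μ i ^ 2)
      (fun i _ hi hc => hi (by simp [hc]))]
  exact sq_sum_le_card_mul_sum_sq

/-- Equality in Cauchy–Schwarz forces all nonzero eigenvalues to coincide; a permutation of the
eigenvectors then lists them first. -/
theorem exists_diagonalization_of_sq_trace_eq {m : ℕ} {G : Matrix (Fin m) (Fin m) ℝ}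
    (hG : G.PosSemidef) (h : G.trace ^ 2 = G.rank * (G * G).trace) :
    ∃ (U : Matrix (Fin m) (Fin m) ℝ) (c : ℝ), Uᵀ * U = 1 ∧ 0 ≤ c ∧ (0 < G.rank → 0 < c) ∧
      Uᵀ * G * U = diagonal fun r : Fin m => if (r : ℕ) < G.rank then c else 0 := by
  obtain ⟨U, μ, hU, hd, hn, hr, h1, h2⟩ := exists_orthogonal_diagonalization hG
  set d := G.rank with hdef
  set s : Finset (Fin m) := Finset.univ.filter fun i => μ i ≠ 0 with hs
  have hcard : s.card = d := by rw [← hr, Fintype.card_subtype]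
  have e1 : G.trace = ∑ i ∈ s, μ i := by rw [h1, hs, Finset.sum_filter_ne_zero]
  have e2 : (G * G).trace = ∑ i ∈ s, μ i ^ 2 := by
    rw [h2, hs, Finset.sum_filter_of_ne]
    exact fun i _ hi hc => hi (by simp [hc])
  -- A scaled variance of the nonzero eigenvalues: the sum equals d (d tr G² - (tr G)²).
  have hzero : ∑ i ∈ s, (d * μ i - G.trace) ^ 2 = 0 := by
    have : ∀ i, (d * μ i - G.trace) ^ 2 =
        (d : ℝ) ^ 2 * μ i ^ 2 - 2 * d * G.trace * μ i + G.trace ^ 2 := fun i => by ring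
    simp only [this, Finset.sum_add_distrib, Finset.sum_sub_distrib, ← Finset.mul_sum, ← e1, ← e2,
      Finset.sum_const, hcard, nsmul_eq_mul]
    rw [h]
    linear_combination (-2 * (d : ℝ)) * h
  have hμ : ∀ i, μ i ≠ 0 → μ i = G.trace / d := by
    intro i hi
    have hmem : i ∈ s := by simp [hs, hi]
    have h3 := (Finset.sum_eq_zero_iff_of_nonneg (fun i _ => sq_nonneg _)).1 hzero i hmem
    have hd0 : (d : ℝ) ≠ 0 := by
      rw [← hcard]
      exact_mod_cast (Finset.card_pos.2 ⟨i, hmem⟩).ne'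
    rw [eq_div_iff hd0]
    linarith [pow_eq_zero_iff (two_ne_zero) |>.1 h3]
  have hdm : d ≤ m := by
    rw [← hcard]
    simpa using Finset.card_le_univ s
  have hc1 : Fintype.card {r : Fin m // (r : ℕ) < d} = Fintype.card {i // μ i ≠ 0} := by
    rw [hr, Fintype.card_subtype, Fin.card_filter_val_lt]
    exact min_eq_right hdm
  have hc2 : Fintype.card {r : Fin m // ¬ (r : ℕ) < d} = Fintype.card {i // ¬ μ i ≠ 0} := by
    rw [Fintype.card_subtype_compl, Fintype.card_subtype_compl, hc1]
  -- Glues a bijection from the first `d` indices to the nonzero eigenvalues with one between the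
  -- complements.
  let σ : Equiv.Perm (Fin m) :=
    Equiv.subtypeCongr (Fintype.equivOfCardEq hc1) (Fintype.equivOfCardEq hc2)
  have hσ : ∀ r : Fin m, μ (σ r) = if (r : ℕ) < d then G.trace / d else 0 := by
    intro r
    by_cases hrd : (r : ℕ) < d
    · have : σ r = (Fintype.equivOfCardEq hc1 ⟨r, hrd⟩ : Fin m) := by
        simp [σ, Equiv.subtypeCongr, hrd]
      rw [if_pos hrd, this]
      exact hμ _ (Fintype.equivOfCardEq hc1 ⟨r, hrd⟩).2
    · have : σ r = (Fintype.equivOfCardEq hc2 ⟨r, hrd⟩ : Fin m) := by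
        simp [σ, Equiv.subtypeCongr, hrd]
      rw [if_neg hrd, this]
      exact not_not.1 (Fintype.equivOfCardEq hc2 ⟨r, hrd⟩).2
  refine ⟨U.submatrix id σ, G.trace / d, ?_, ?_, ?_, ?_⟩
  · rw [Matrix.transpose_submatrix]
    refine (Matrix.submatrix_mul_equiv _ _ _ (Equiv.refl _) _).trans ?_
    rw [hU, Matrix.submatrix_one_equiv]
  · rw [h1]
    exact div_nonneg (Finset.sum_nonneg fun i _ => hn i) (Nat.cast_nonneg _)
  · intro hpos
    obtain ⟨i, hi⟩ := Finset.card_pos.1 (hcard ▸ hpos)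
    have hi' : μ i ≠ 0 := by simpa [hs] using hi
    rw [← hμ i hi']
    exact lt_of_le_of_ne (hn i) (Ne.symm hi')
  · have : (U.submatrix id σ)ᵀ * G * U.submatrix id σ = (Uᵀ * G * U).submatrix σ σ := by
      ext i j
      simp [Matrix.mul_apply]
    rw [this, hd]
    ext i j
    by_cases hij : i = j
    · subst hij
      simp [hσ]
    · simp [hij]

end Matrices

/-- Applied with T = tr G and S = tr G². For d > 0 the squares of the two sides differ by (dS -
T²)/(2d), so the inequality and its equality case both reduce to comparing T² with dS. -/
theorem sqrt_half_le_and_eq_iff (d : ℕ) {T S : ℝ} (hT : 0 ≤ T) (hS0 : 0 ≤ S) (hS : S ≤ T ^ 2)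
    (hTS : T ^ 2 ≤ d * S) :
    Real.sqrt ((T ^ 2 - S) / 2) ≤ Real.sqrt (((d : ℝ) - 1) / (2 * d)) * T ∧
      (Real.sqrt ((T ^ 2 - S) / 2) = Real.sqrt (((d : ℝ) - 1) / (2 * d)) * T ↔
        T ^ 2 = d * S) := by
  -- For d = 0, division by zero makes the coefficient √0 = 0, as the theorem prescribes, while
  -- `hTS` forces T = 0 and then S = 0.
  rcases Nat.eq_zero_or_pos d with rfl | hd
  · have hT0 : T = 0 := by
      have : T ^ 2 = 0 := le_antisymm (by simpa using hTS) (sq_nonneg T)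
      exact pow_eq_zero_iff two_ne_zero |>.1 this
    subst hT0
    have hS1 : S = 0 := le_antisymm (by simpa using hS) hS0
    simp [hS1]
  · have hd1 : (1 : ℝ) ≤ d := by exact_mod_cast hd
    have hd0 : (0 : ℝ) < d := by linarith
    have hnn : 0 ≤ ((d : ℝ) - 1) / (2 * d) := div_nonneg (by linarith) (by linarith)
    have e1 : Real.sqrt (((d : ℝ) - 1) / (2 * d)) * T =
        Real.sqrt (((d : ℝ) - 1) / (2 * d) * T ^ 2) := by
      rw [Real.sqrt_mul hnn, Real.sqrt_sq hT]
    have e2 : ((d : ℝ) - 1) / (2 * d) * T ^ 2 - (T ^ 2 - S) / 2 = (d * S - T ^ 2) / (2 * d) := by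
      field_simp
      ring
    rw [e1]
    refine ⟨Real.sqrt_le_sqrt ?_, ?_⟩
    · have : 0 ≤ (d * S - T ^ 2) / (2 * d) := div_nonneg (by linarith) (by linarith)
      linarith
    · rw [Real.sqrt_inj (by linarith) (mul_nonneg hnn (sq_nonneg T)), ← sub_eq_zero,
        ← neg_eq_zero, neg_sub, e2, div_eq_zero_iff, sub_eq_zero]
      constructor
      · rintro (h | h)
        · exact h.symm
        · linarith
      · exact fun h => Or.inl h.symm

/-- Lagrange's identity. -/
theorem sum_sum_sub_mul_self {ι : Type*} [Fintype ι] (a b : ι → ℝ) :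
    ∑ i, ∑ j, (a j * b i - a i * b j) * (a j * b i - a i * b j) =
      2 * ((∑ i, a i * a i) * (∑ i, b i * b i) - (∑ i, a i * b i) * ∑ i, a i * b i) := by
  have h1 : ∀ i j, (a j * b i - a i * b j) * (a j * b i - a i * b j) =
      (b i * b i) * (a j * a j) + (a i * a i) * (b j * b j) - 2 * ((a i * b i) * (a j * b j)) :=
    fun i j => by ring
  simp only [h1, Finset.sum_add_distrib, Finset.sum_sub_distrib, ← Finset.mul_sum,
    ← Finset.sum_mul]
  ring

/-! ### Scalar curvatures in terms of the Gram matrix. -/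

section Submanifold

variable {k l : ℕ} {M N : Type*} [TopologicalSpace M]
  [ChartedSpace (EuclideanSpace ℝ (Fin (k + 1))) M]
  [IsManifold (𝓡 (k + 1)) ∞ M] [TopologicalSpace N] [ChartedSpace (EuclideanSpace ℝ (Fin l)) N]
  [IsManifold (𝓡 l) ∞ N] {g : SmoothMetric (k + 1) M} {h : SmoothMetric l N} {f : M → N}

theorem tangentFrame_orthonormal (g : SmoothMetric (k + 1) M) (p : M) :
    IsOrthonormalFor (fun v w => g.inner p v w) (tangentFrame g p) :=
  (exists_tangentFrame g p).choose_spec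

theorem normalFrame_orthonormal (h : SmoothMetric l N) (f : M → N) (p : M) :
    IsOrthonormalFor (fun v w => h.inner (f p) v.1 w.1) (normalFrame (n := k + 1) h f p) :=
  (exists_normalFrame h f p).choose_spec

theorem finrank_tangentSpace (p : M) :
    Module.finrank ℝ (TangentSpace (𝓡 (k + 1)) p) = k + 1 :=
  finrank_euclideanSpace_fin (𝕜 := ℝ) (n := k + 1)

/-- For a second fundamental form of type `Q(k, 1)` with respect to `e`, where `II_ξ` has the
off-diagonal block `a_ξ`, this is the bilinear form `a_ξ · a_η` on the normal space. -/
noncomputable def gramForm (h : SmoothMetric l N) (f : M → N) (p : M)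
    (e : Fin k ⊕ Fin 1 → TangentSpace (𝓡 (k + 1)) p) (ξ η : normalSpace (n := k + 1) h f p) : ℝ :=
  ∑ i, secondFund h f p ξ (e (Sum.inl i)) (e (Sum.inr 0)) *
    secondFund h f p η (e (Sum.inl i)) (e (Sum.inr 0))

theorem matrixOf_mem_austereQ_iff {V : Type*} {B : V → V → ℝ} {e : Fin k ⊕ Fin 1 → V} :
    matrixOf B e ∈ austereQ k 1 ↔
      (∀ i j, B (e (Sum.inl i)) (e (Sum.inl j)) = 0) ∧
      (∀ i, B (e (Sum.inr 0)) (e (Sum.inl i)) = B (e (Sum.inl i)) (e (Sum.inr 0))) ∧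
      B (e (Sum.inr 0)) (e (Sum.inr 0)) = 0 := by
  constructor
  · rintro ⟨a, ha⟩
    have h1 : ∀ i j, B (e i) (e j) = Matrix.fromBlocks 0 a a.transpose 0 i j := fun i j =>
      congrFun (congrFun ha i) j
    simp [h1]
  · rintro ⟨h1, h2, h3⟩
    refine ⟨Matrix.of fun i j => B (e (Sum.inl i)) (e (Sum.inr j)), ?_⟩
    ext (i | i) (j | j)
    · simp [matrixOf, h1]
    · simp [matrixOf]
    · obtain rfl := Subsingleton.elim i 0
      simp [matrixOf, h2]
    · obtain rfl := Subsingleton.elim i 0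
      obtain rfl := Subsingleton.elim j 0
      simp [matrixOf, h3]

namespace IsIsometricImmersion

theorem exists_gramForm_eq (hf : IsIsometricImmersion g h f) (p : M)
    (e : Fin k ⊕ Fin 1 → TangentSpace (𝓡 (k + 1)) p) :
    ∃ β : normalSpace (n := k + 1) h f p →ₗ[ℝ] normalSpace (n := k + 1) h f p →ₗ[ℝ] ℝ,
      ∀ ξ η, gramForm h f p e ξ η = β ξ η := by
  obtain ⟨L, hL⟩ := hf.exists_secondFund_eq p
  refine ⟨LinearMap.mk₂ ℝ (fun ξ η => ∑ i, L ξ (e (Sum.inl i)) (e (Sum.inr 0)) *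
    L η (e (Sum.inl i)) (e (Sum.inr 0))) ?_ ?_ ?_ ?_, ?_⟩
  · intro a b c
    simp [add_mul, Finset.sum_add_distrib]
  · intro c a b
    simp [mul_assoc, Finset.mul_sum]
  · intro a b c
    simp [mul_add, Finset.sum_add_distrib]
  · intro c a b
    rw [smul_eq_mul, Finset.mul_sum]
    refine Finset.sum_congr rfl fun i _ => ?_
    rw [map_smul, LinearMap.smul_apply, LinearMap.smul_apply, smul_eq_mul]
    ring
  · intro ξ η
    simp [gramForm, hL]

/-- The traces of the Gram matrix do not depend on the orthonormal normal frame. -/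
theorem sum_gramForm_eq (hf : IsIsometricImmersion g h f) (p : M)
    (e : Fin k ⊕ Fin 1 → TangentSpace (𝓡 (k + 1)) p) {ι ι' : Type*} [Fintype ι] [Fintype ι']
    {ξ : Module.Basis ι ℝ (normalSpace (n := k + 1) h f p)}
    {ξ' : Module.Basis ι' ℝ (normalSpace (n := k + 1) h f p)}
    (hξ : IsOrthonormalFor (fun v w => h.inner (f p) v.1 w.1) ξ)
    (hξ' : IsOrthonormalFor (fun v w => h.inner (f p) v.1 w.1) ξ') :
    ∑ r, gramForm h f p e (ξ r) (ξ r) = ∑ r, gramForm h f p e (ξ' r) (ξ' r) ∧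
    ∑ r, ∑ s, gramForm h f p e (ξ r) (ξ s) ^ 2 =
      ∑ r, ∑ s, gramForm h f p e (ξ' r) (ξ' s) ^ 2 := by
  obtain ⟨β, hβ⟩ := hf.exists_gramForm_eq p e
  simp only [hβ, sq]
  have hs : ∀ v w, (metricForm h (f p)).restrict (normalSpace (n := k + 1) h f p) v w =
      (metricForm h (f p)).restrict (normalSpace (n := k + 1) h f p) w v := fun v w =>
    h.symm (f p) v.1 w.1
  exact ⟨IsOrthonormalFor.sum_apply_self_eq hs hξ hξ' β,
    IsOrthonormalFor.sum_sum_mul_eq hs hξ hξ' β β⟩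

variable {κ : ℝ} {p : M} {e : Module.Basis (Fin k ⊕ Fin 1) ℝ (TangentSpace (𝓡 (k + 1)) p)}

/-- The scalar curvature of a submanifold of type `Q(k, 1)` of a space form. -/
theorem sub_normScalarCurv_eq (hf : IsIsometricImmersion g h f) (hN : HasConstantCurvature h κ)
    (hk : 1 ≤ k) (he : IsOrthonormalFor (fun u v => g.inner p u v) e)
    (hq : ∀ ξ, matrixOf (secondFund h f p ξ) e ∈ austereQ k 1) {ι : Type*} [Fintype ι]
    {ξ : Module.Basis ι ℝ (normalSpace (n := k + 1) h f p)}
    (hξ : IsOrthonormalFor (fun v w => h.inner (f p) v.1 w.1) ξ) :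
    κ - normScalarCurv g p =
      2 / (((k + 1 : ℕ) : ℝ) * (((k + 1 : ℕ) : ℝ) - 1)) *
        ∑ r, gramForm h f p e (ξ r) (ξ r) := by
  obtain ⟨L, hL⟩ := hf.exists_secondFund_eq p
  have ht := tangentFrame_orthonormal g p
  have hgs : ∀ v w, metricForm g p v w = metricForm g p w v := fun v w => g.symm p v w
  have hR := hf.riemann_eq hN p ξ hξ
  set t := tangentFrame g p with htdef
  simp only [matrixOf_mem_austereQ_iff] at hq
  have h1 : ∑ i, ∑ j, (g.inner p (t i) (t i) * g.inner p (t j) (t j) - g.inner p (t i) (t j) ^ 2) =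
      ((k + 1 : ℕ) : ℝ) * (((k + 1 : ℕ) : ℝ) - 1) := by
    have hii : ∀ i, g.inner p (t i) (t i) = 1 := ht.1
    have hij : ∀ i j, g.inner p (t i) (t j) ^ 2 = if i = j then 1 else 0 := by
      intro i j
      split_ifs with hij
      · subst hij; rw [hii, one_pow]
      · have : g.inner p (t i) (t j) = 0 := ht.2 i j hij
        rw [this]; norm_num
    simp only [hii, hij, Finset.sum_sub_distrib, Finset.sum_ite_eq, Finset.mem_univ, if_true,
      Finset.sum_const, Finset.card_univ, Fintype.card_fin, finrank_tangentSpace, nsmul_eq_mul]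
    ring
  have h2 : ∀ r, ∑ i, ∑ j, (secondFund h f p (ξ r) (t i) (t i) * secondFund h f p (ξ r) (t j) (t j) -
      secondFund h f p (ξ r) (t i) (t j) * secondFund h f p (ξ r) (t j) (t i)) =
      -(2 * gramForm h f p e (ξ r) (ξ r)) := by
    intro r
    obtain ⟨q1, q2, q3⟩ := hq (ξ r)
    -- In the frame `e` both diagonal blocks vanish: the trace is zero, and the product with the
    -- transposed form gives 2|a|².
    have ht1 := IsOrthonormalFor.sum_apply_self_eq (B := metricForm g p) hgs ht he (L (ξ r))
    have ht2 := IsOrthonormalFor.sum_sum_mul_eq (B := metricForm g p) hgs ht he (L (ξ r))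
      (L (ξ r)).flip
    simp only [LinearMap.flip_apply, ← hL, Fintype.sum_sum_type, Finset.univ_unique,
      Fin.default_eq_zero, Finset.sum_singleton, q1, q2, q3, mul_zero, Finset.sum_const_zero,
      add_zero, zero_add] at ht1 ht2
    simp only [Finset.sum_sub_distrib, ← Finset.mul_sum, ← Finset.sum_mul]
    rw [ht1, ht2, gramForm]
    ring
  have hsum : ∑ i, ∑ j, riemann g p (t i) (t j) (t j) (t i) =
      κ * (((k + 1 : ℕ) : ℝ) * (((k + 1 : ℕ) : ℝ) - 1)) -
        2 * ∑ r, gramForm h f p e (ξ r) (ξ r) := by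
    simp only [hR, Finset.sum_add_distrib, ← Finset.mul_sum, h1]
    have h3 : ∀ i, ∑ j, ∑ r, (secondFund h f p (ξ r) (t i) (t i) *
        secondFund h f p (ξ r) (t j) (t j) -
        secondFund h f p (ξ r) (t i) (t j) * secondFund h f p (ξ r) (t j) (t i)) =
        ∑ r, ∑ j, (secondFund h f p (ξ r) (t i) (t i) *
        secondFund h f p (ξ r) (t j) (t j) -
        secondFund h f p (ξ r) (t i) (t j) * secondFund h f p (ξ r) (t j) (t i)) :=
      fun i => Finset.sum_comm
    simp only [h3]
    rw [Finset.sum_comm]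
    simp only [h2, Finset.sum_neg_distrib, ← Finset.mul_sum]
    ring
  have hrs : ∀ i j, riemann g p (t i) (t j) (t j) (t i) = riemann g p (t j) (t i) (t i) (t j) := by
    intro i j
    rw [hR, hR, g.symm p (t i) (t j)]
    congr 1
    · ring
    · exact Finset.sum_congr rfl fun r _ => by ring
  have hr0 : ∀ i, riemann g p (t i) (t i) (t i) (t i) = 0 := by
    intro i
    rw [hR]
    simp [sq]
  have hk' : (1 : ℝ) ≤ k := by exact_mod_cast hk
  rw [normScalarCurv, sum_ite_lt_eq (fun i j => riemann g p (t i) (t j) (t j) (t i)) hrs hr0, hsum]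
  push_cast
  have : (k : ℝ) + 1 ≠ 0 := by linarith
  have : (k : ℝ) + 1 - 1 ≠ 0 := by linarith
  field_simp
  ring

/-- The normal scalar curvature of a submanifold of type `Q(k, 1)` of a space form. -/
theorem normNormalScalarCurv_eq (hf : IsIsometricImmersion g h f) (hN : HasConstantCurvature h κ)
    (he : IsOrthonormalFor (fun u v => g.inner p u v) e)
    (hq : ∀ ξ, matrixOf (secondFund h f p ξ) e ∈ austereQ k 1) {ι : Type*} [Fintype ι]
    {ξ : Module.Basis ι ℝ (normalSpace (n := k + 1) h f p)}
    (hξ : IsOrthonormalFor (fun v w => h.inner (f p) v.1 w.1) ξ) :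
    normNormalScalarCurv g h f p =
      2 / (((k + 1 : ℕ) : ℝ) * (((k + 1 : ℕ) : ℝ) - 1)) *
        Real.sqrt (((∑ r, gramForm h f p e (ξ r) (ξ r)) ^ 2 -
          ∑ r, ∑ s, gramForm h f p e (ξ r) (ξ s) ^ 2) / 2) ∧
    ∑ r, ∑ s, gramForm h f p e (ξ r) (ξ s) ^ 2 ≤ (∑ r, gramForm h f p e (ξ r) (ξ r)) ^ 2 := by
  obtain ⟨L, hL⟩ := hf.exists_secondFund_eq p
  have ht := tangentFrame_orthonormal g p
  have hν := normalFrame_orthonormal (k := k) h f p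
  have hgs : ∀ v w, metricForm g p v w = metricForm g p w v := fun v w => g.symm p v w
  have hK := hf.normalCurv_eq hN p e he
  simp only [matrixOf_mem_austereQ_iff] at hq
  obtain ⟨hT, hS⟩ := hf.sum_gramForm_eq p e hξ hν
  rw [hT, hS]
  set t := tangentFrame g p with htdef
  set ν := normalFrame (n := k + 1) h f p with hνdef
  have h1 : ∀ ξ η, ∑ i, ∑ j, normalCurv h f p (t i) (t j) ξ η ^ 2 =
      2 * (gramForm h f p e ξ ξ * gramForm h f p e η η - gramForm h f p e ξ η ^ 2) := by
    intro ξ η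
    obtain ⟨q1, q2, q3⟩ := hq ξ
    obtain ⟨q1', q2', q3'⟩ := hq η
    -- A bilinear version of the normal curvature for fixed normal vectors, so that its squared norm
    -- can be moved from the chosen frame `t` to the frame `e`.
    let K : TangentSpace (𝓡 (k + 1)) p →ₗ[ℝ] TangentSpace (𝓡 (k + 1)) p →ₗ[ℝ] ℝ :=
      LinearMap.mk₂ ℝ (fun u v => ∑ a, (L ξ v (e a) * L η u (e a) - L ξ u (e a) * L η v (e a)))
        (fun u u' v => by
          rw [← Finset.sum_add_distrib]
          refine Finset.sum_congr rfl fun a _ => ?_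
          simp only [map_add, LinearMap.add_apply]
          ring)
        (fun c u v => by
          rw [smul_eq_mul, Finset.mul_sum]
          refine Finset.sum_congr rfl fun a _ => ?_
          simp only [map_smul, LinearMap.smul_apply, smul_eq_mul]
          ring)
        (fun u v v' => by
          rw [← Finset.sum_add_distrib]
          refine Finset.sum_congr rfl fun a _ => ?_
          simp only [map_add, LinearMap.add_apply]
          ring)
        (fun c u v => by
          rw [smul_eq_mul, Finset.mul_sum]
          refine Finset.sum_congr rfl fun a _ => ?_
          simp only [map_smul, LinearMap.smul_apply, smul_eq_mul]
          ring)
    have hKL : ∀ u v, normalCurv h f p u v ξ η = K u v := fun u v => by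
      rw [hK]
      simp [K, hL]
    have h2 := IsOrthonormalFor.sum_sum_mul_eq (B := metricForm g p) hgs ht he K K
    simp only [hKL, sq]
    rw [h2]
    simp only [← hKL]
    -- The commutator of two matrices of type Q(k,1) lives in the k × k block, where its entries are
    -- the coordinates of the wedge of the two vectors; `k2`, `k3` and `k4` dispose of the rest.
    have k1 : ∀ i j, normalCurv h f p (e (Sum.inl i)) (e (Sum.inl j)) ξ η =
        secondFund h f p ξ (e (Sum.inl j)) (e (Sum.inr 0)) *
          secondFund h f p η (e (Sum.inl i)) (e (Sum.inr 0)) -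
        secondFund h f p ξ (e (Sum.inl i)) (e (Sum.inr 0)) *
          secondFund h f p η (e (Sum.inl j)) (e (Sum.inr 0)) := by
      intro i j
      simp [hK, q1, q1']
    have k2 : ∀ i, normalCurv h f p (e (Sum.inl i)) (e (Sum.inr 0)) ξ η = 0 := by
      intro i
      simp [hK, q1, q1', q3, q3']
    have k3 : ∀ i, normalCurv h f p (e (Sum.inr 0)) (e (Sum.inl i)) ξ η = 0 := by
      intro i
      simp [hK, q1, q1', q3, q3']
    have k4 : normalCurv h f p (e (Sum.inr 0)) (e (Sum.inr 0)) ξ η = 0 := by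
      simp [hK]
    simp only [Fintype.sum_sum_type, Finset.univ_unique, Fin.default_eq_zero,
      Finset.sum_singleton, k1, k2, k3, k4, mul_zero, Finset.sum_const_zero, add_zero, gramForm]
    rw [sum_sum_sub_mul_self]
  have a1 : ∀ (u v : TangentSpace (𝓡 (k + 1)) p) (ξ η : normalSpace (n := k + 1) h f p),
      normalCurv h f p u v ξ η = -normalCurv h f p v u ξ η := by
    intro u v ξ η
    rw [hK, hK, ← Finset.sum_neg_distrib]
    exact Finset.sum_congr rfl fun _ _ => by ring
  have a2 : ∀ (u v : TangentSpace (𝓡 (k + 1)) p) (ξ η : normalSpace (n := k + 1) h f p),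
      normalCurv h f p u v ξ η = -normalCurv h f p u v η ξ := by
    intro u v ξ η
    rw [hK, hK, ← Finset.sum_neg_distrib]
    exact Finset.sum_congr rfl fun _ _ => by ring
  have a10 : ∀ (u : TangentSpace (𝓡 (k + 1)) p) (ξ η : normalSpace (n := k + 1) h f p),
      normalCurv h f p u u ξ η = 0 := fun u ξ η => by linarith [a1 u u ξ η]
  have a20 : ∀ (u v : TangentSpace (𝓡 (k + 1)) p) (ξ : normalSpace (n := k + 1) h f p),
      normalCurv h f p u v ξ ξ = 0 := fun u v ξ => by linarith [a2 u v ξ ξ]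
  have h4 : ∀ i j, ∑ r, ∑ s, (if r < s then normalCurv h f p (t i) (t j) (ν r) (ν s) ^ 2 else 0) =
      1 / 2 * ∑ r, ∑ s, normalCurv h f p (t i) (t j) (ν r) (ν s) ^ 2 := fun i j =>
    sum_ite_lt_eq (fun r s => normalCurv h f p (t i) (t j) (ν r) (ν s) ^ 2)
      (fun r s => by rw [a2, neg_sq]) (fun r => by rw [a20]; norm_num)
  -- The restrictions i < j and r < s each halve the full sum. The resulting 1/4, with the factor 2
  -- from Lagrange's identity, gives the division by 2 under the root.
  have h5 : ∑ i, ∑ j, (if i < j then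
      ∑ r, ∑ s, (if r < s then normalCurv h f p (t i) (t j) (ν r) (ν s) ^ 2 else 0) else 0) =
      1 / 2 * ∑ i, ∑ j, (1 / 2 * ∑ r, ∑ s, normalCurv h f p (t i) (t j) (ν r) (ν s) ^ 2) := by
    simp only [h4]
    refine sum_ite_lt_eq (fun i j => 1 / 2 * ∑ r, ∑ s,
      normalCurv h f p (t i) (t j) (ν r) (ν s) ^ 2) (fun i j => ?_) (fun i => ?_)
    · simp only [a1 (t i) (t j), neg_sq]
    · simp [a10]
  have h6 : ∑ i, ∑ j, ∑ r, ∑ s, normalCurv h f p (t i) (t j) (ν r) (ν s) ^ 2 =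
      2 * ((∑ r, gramForm h f p e (ν r) (ν r)) ^ 2 -
        ∑ r, ∑ s, gramForm h f p e (ν r) (ν s) ^ 2) := by
    have e1 : ∑ i, ∑ j, ∑ r, ∑ s, normalCurv h f p (t i) (t j) (ν r) (ν s) ^ 2 =
        ∑ r, ∑ s, ∑ i, ∑ j, normalCurv h f p (t i) (t j) (ν r) (ν s) ^ 2 := by
      simp only [Finset.sum_comm (s := Finset.univ (α := Fin (Module.finrank ℝ
        (TangentSpace (𝓡 (k + 1)) p)))) (t := Finset.univ (α := Fin (Module.finrank ℝ
        (normalSpace (n := k + 1) h f p))))]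
    rw [e1]
    simp only [h1, ← Finset.mul_sum, Finset.sum_sub_distrib]
    rw [sq, Finset.sum_mul_sum]
    simp only [Finset.mul_sum]
  simp only [← Finset.mul_sum] at h5
  rw [h6] at h5
  constructor
  · rw [normNormalScalarCurv, h5]
    congr 2
    ring
  -- By `h6`, the radicand's numerator (tr G)² - tr G² is half a sum of squares.
  · have h7 : 0 ≤ ∑ i, ∑ j, ∑ r, ∑ s, normalCurv h f p (t i) (t j) (ν r) (ν s) ^ 2 :=
      Finset.sum_nonneg fun i _ => Finset.sum_nonneg fun j _ => Finset.sum_nonneg fun r _ =>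
        Finset.sum_nonneg fun s _ => sq_nonneg _
    linarith

end IsIsometricImmersion

end Submanifold

/-! ### Dimension of the normal space. -/

section Submanifold

variable {n l : ℕ} {M N : Type*} [TopologicalSpace M] [ChartedSpace (EuclideanSpace ℝ (Fin n)) M]
  [IsManifold (𝓡 n) ∞ M] [TopologicalSpace N] [ChartedSpace (EuclideanSpace ℝ (Fin l)) N]
  [IsManifold (𝓡 l) ∞ N] {g : SmoothMetric n M} {h : SmoothMetric l N} {f : M → N}

/-- The normal space is the orthogonal complement, for a nondegenerate form, of the image of an
injective differential. -/
theorem IsIsometricImmersion.finrank_normalSpace_add (hf : IsIsometricImmersion g h f) (p : M) :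
    Module.finrank ℝ (normalSpace (n := n) h f p) + n = l := by
  set D : TangentSpace (𝓡 n) p →ₗ[ℝ] TangentSpace (𝓡 l) (f p) :=
    (mfderiv (𝓡 n) (𝓡 l) f p).toLinearMap with hD
  have hDinj : Function.Injective D := by
    rw [injective_iff_map_eq_zero]
    intro u hu
    by_contra hne
    have h1 := g.pos p u hne
    rw [← hf.2 p u u] at h1
    have h2 : mfderiv (𝓡 n) (𝓡 l) f p u = 0 := hu
    rw [h2, map_zero] at h1
    exact lt_irrefl _ h1
  have hnd : (metricForm h (f p)).Nondegenerate := by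
    constructor
    · intro v hv
      by_contra hne
      exact (h.pos (f p) v hne).ne' (hv v)
    · intro v hv
      by_contra hne
      exact (h.pos (f p) v hne).ne' (hv v)
  have horth : normalSpace (n := n) h f p = (metricForm h (f p)).orthogonal (LinearMap.range D) := by
    ext ξ
    rw [LinearMap.BilinForm.mem_orthogonal_iff]
    constructor
    · rintro hξ _ ⟨u, rfl⟩
      exact hξ u
    · intro hξ u
      exact hξ _ ⟨u, rfl⟩
  have h1 : Module.finrank ℝ (TangentSpace (𝓡 n) p) = n :=
    finrank_euclideanSpace_fin (𝕜 := ℝ) (n := n)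
  have h2 : Module.finrank ℝ (TangentSpace (𝓡 l) (f p)) = l :=
    finrank_euclideanSpace_fin (𝕜 := ℝ) (n := l)
  have h3 := LinearMap.finrank_range_of_inj hDinj
  have h4 := Submodule.finrank_le (LinearMap.range D)
  rw [horth, LinearMap.BilinForm.finrank_orthogonal hnd]
  omega

end Submanifold

/-! ### Rank of the Gram matrix and adapted frames. -/

section Submanifold

variable {k l : ℕ} {M N : Type*} [TopologicalSpace M]
  [ChartedSpace (EuclideanSpace ℝ (Fin (k + 1))) M]
  [IsManifold (𝓡 (k + 1)) ∞ M] [TopologicalSpace N] [ChartedSpace (EuclideanSpace ℝ (Fin l)) N]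
  [IsManifold (𝓡 l) ∞ N] {g : SmoothMetric (k + 1) M} {h : SmoothMetric l N} {f : M → N}
  {κ : ℝ} {p : M} {e : Module.Basis (Fin k ⊕ Fin 1) ℝ (TangentSpace (𝓡 (k + 1)) p)}

namespace IsIsometricImmersion

open Matrix

/-- The Gram matrix of a second fundamental form of type `Q(k, 1)` is positive semidefinite, and
its rank is the dimension of `|II|`. -/
theorem posSemidef_gramForm (hf : IsIsometricImmersion g h f)
    (hq : ∀ ξ, matrixOf (secondFund h f p ξ) e ∈ austereQ k 1) {ι : Type*} [Fintype ι]
    [DecidableEq ι] (ξ : Module.Basis ι ℝ (normalSpace (n := k + 1) h f p)) :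
    (matrixOf (gramForm h f p e) ξ).PosSemidef ∧
      (matrixOf (gramForm h f p e) ξ).rank =
        Module.finrank ℝ (secondFundSpan (n := k + 1) h f p) ∧
      (matrixOf (gramForm h f p e) ξ).rank ≤ k := by
  obtain ⟨L, hL⟩ := hf.exists_secondFund_eq p
  simp only [matrixOf_mem_austereQ_iff, hL] at hq
  let a : normalSpace (n := k + 1) h f p →ₗ[ℝ] (Fin k → ℝ) :=
    LinearMap.pi fun i => (L.flip (e (Sum.inl i))).flip (e (Sum.inr 0))
  let A : Matrix ι (Fin k) ℝ := (LinearMap.toMatrix ξ (Pi.basisFun ℝ (Fin k)) a)ᵀ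
  have hG : matrixOf (gramForm h f p e) ξ = A * Aᵀ := by
    ext r s
    simp [matrixOf, gramForm, Matrix.mul_apply, A, a, LinearMap.toMatrix_apply, hL]
  have hA : A.rank = Module.finrank ℝ (LinearMap.range a) := by
    rw [Matrix.rank_transpose, Matrix.rank_eq_finrank_range_toLin _ (Pi.basisFun ℝ (Fin k)) ξ,
      Matrix.toLin_toMatrix]
  let J : normalSpace (n := k + 1) h f p →ₗ[ℝ]
      (TangentSpace (𝓡 (k + 1)) p → TangentSpace (𝓡 (k + 1)) p → ℝ) :=
    { toFun := fun ξ u v => L ξ u v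
      map_add' := fun ξ η => by ext u v; simp
      map_smul' := fun c ξ => by ext u v; simp }
  -- The forms II_ξ already make up a linear subspace, so taking the span adds nothing.
  have hspan : secondFundSpan (n := k + 1) h f p = LinearMap.range J := by
    have : Set.range (secondFund (n := k + 1) h f p) = LinearMap.range J := by
      rw [LinearMap.coe_range]
      congr 1
      ext ξ u v
      exact hL ξ u v
    rw [secondFundSpan, this, Submodule.span_eq]
  -- A form of type Q(k,1) is zero exactly when its off-diagonal block is. Rank–nullity then equates
  -- the ranks of ξ ↦ a_ξ and ξ ↦ II_ξ.
  have hker : LinearMap.ker a = LinearMap.ker J := by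
    ext ζ
    rw [LinearMap.mem_ker, LinearMap.mem_ker]
    constructor
    · intro h0
      have h1 : ∀ i, L ζ (e (Sum.inl i)) (e (Sum.inr 0)) = 0 := fun i => congrFun h0 i
      have h2 : L ζ = 0 := by
        obtain ⟨q1, q2, q3⟩ := hq ζ
        refine LinearMap.ext_basis e e fun i j => ?_
        rcases i with i | i <;> rcases j with j | j
        · simp [q1]
        · obtain rfl := Subsingleton.elim j 0
          simp [h1]
        · obtain rfl := Subsingleton.elim i 0
          simp [q2, h1]
        · obtain rfl := Subsingleton.elim i 0
          obtain rfl := Subsingleton.elim j 0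
          simp [q3]
      ext u v
      simp [J, h2]
    · intro h0
      ext i
      exact congrFun (congrFun h0 _) _
  have e1 := LinearMap.finrank_range_add_finrank_ker a
  have e2 := LinearMap.finrank_range_add_finrank_ker J
  rw [hker] at e1
  have hrank : (A * Aᵀ).rank = A.rank := Matrix.rank_self_mul_transpose A
  rw [hG, hrank]
  refine ⟨?_, ?_, ?_⟩
  · have := Matrix.posSemidef_self_mul_conjTranspose A
    rwa [Matrix.conjTranspose_eq_transpose_of_trivial] at this
  · rw [hA, hspan]
    omega
  · simpa using A.rank_le_card_width

/-- In the normal frame rotated by `U`, the first `d` vectors a_r are orthogonal of length √c and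
the others vanish. Divided by √c, those `d` vectors extend to an orthonormal basis of ℝ^k. Using
this basis to rotate the first k tangent vectors, with the last one fixed, sends a_r to √c times the
r-th axis. -/
theorem exists_frames (hf : IsIsometricImmersion g h f)
    (he : IsOrthonormalFor (fun u v => g.inner p u v) e)
    (hq : ∀ ξ, matrixOf (secondFund h f p ξ) e ∈ austereQ k 1) {m d : ℕ}
    {ξ₀ : Module.Basis (Fin m) ℝ (normalSpace (n := k + 1) h f p)}
    (hξ₀ : IsOrthonormalFor (fun v w => h.inner (f p) v.1 w.1) ξ₀)
    {U : Matrix (Fin m) (Fin m) ℝ} {c : ℝ} (hU : Uᵀ * U = 1) (hc : 0 < d → 0 < c) (hdm : d ≤ m)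
    (hdk : d ≤ k)
    (hdiag : Uᵀ * matrixOf (gramForm h f p e) ξ₀ * U =
      diagonal fun r : Fin m => if (r : ℕ) < d then c else 0) :
    ∃ (e' : Module.Basis (Fin k ⊕ Fin 1) ℝ (TangentSpace (𝓡 (k + 1)) p))
      (ξ : Module.Basis (Fin m) ℝ (normalSpace (n := k + 1) h f p)),
      IsOrthonormalFor (fun u v => g.inner p u v) e' ∧
      IsOrthonormalFor (fun v w => h.inner (f p) v.1 w.1) ξ ∧
      ∀ r, (∀ i j, secondFund h f p (ξ r) (e' (Sum.inl i)) (e' (Sum.inl j)) = 0) ∧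
        secondFund h f p (ξ r) (e' (Sum.inr 0)) (e' (Sum.inr 0)) = 0 ∧
        ∀ i, secondFund h f p (ξ r) (e' (Sum.inl i)) (e' (Sum.inr 0)) =
            (if (r : ℕ) < d ∧ (i : ℕ) = r then Real.sqrt c else 0) ∧
          secondFund h f p (ξ r) (e' (Sum.inr 0)) (e' (Sum.inl i)) =
            (if (r : ℕ) < d ∧ (i : ℕ) = r then Real.sqrt c else 0) := by
  obtain ⟨β, hβ⟩ := hf.exists_gramForm_eq p e
  have hξ' := IsOrthonormalFor.of_orthogonal
    (B := (metricForm h (f p)).restrict (normalSpace (n := k + 1) h f p)) hξ₀ hU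
  obtain ⟨ξ, hξ⟩ := hξ'.exists_basis (Module.finrank_eq_card_basis ξ₀).symm
  have hβξ : ∀ r s, gramForm h f p e (ξ r) (ξ s) =
      if r = s then (if (r : ℕ) < d then c else 0) else 0 := by
    intro r s
    have h1 := congrFun (congrFun hdiag r) s
    rw [Matrix.diagonal_apply] at h1
    rw [← h1, hβ, hξ]
    simp only [map_sum, map_smul, LinearMap.sum_apply, LinearMap.smul_apply, smul_eq_mul,
      Matrix.mul_apply, Matrix.transpose_apply, matrixOf, Matrix.of_apply, hβ, Finset.sum_mul,
      Finset.mul_sum]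
    exact Finset.sum_congr rfl fun i _ => Finset.sum_congr rfl fun j _ => by ring
  let w : Fin m → EuclideanSpace ℝ (Fin k) := fun r => WithLp.toLp 2 fun i =>
    secondFund h f p (ξ r) (e (Sum.inl i)) (e (Sum.inr 0))
  have hin : ∀ x y : EuclideanSpace ℝ (Fin k), inner ℝ x y = ∑ i, x i * y i := fun x y => by
    rw [PiLp.inner_apply]
    exact Finset.sum_congr rfl fun i _ => mul_comm _ _
  have hw : ∀ r s, inner ℝ (w r) (w s) = if r = s then (if (r : ℕ) < d then c else 0) else 0 := by
    intro r s
    rw [← hβξ r s, gramForm, hin]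
  -- Only indices below `d` are prescribed, and they are below `m` by `hdm`. The other values,
  -- including the filler 0, are ignored by the basis extension.
  let v : Fin k → EuclideanSpace ℝ (Fin k) := fun i =>
    if hi : (i : ℕ) < m then (Real.sqrt c)⁻¹ • w ⟨i, hi⟩ else 0
  have hv : Orthonormal ℝ (Set.domRestrict {i : Fin k | (i : ℕ) < d} v) := by
    rw [orthonormal_iff_ite]
    rintro ⟨i, hi⟩ ⟨j, hj⟩
    have hi : (i : ℕ) < d := hi
    have hj : (j : ℕ) < d := hj
    have hc' := hc (by omega)
    simp only [Set.domRestrict_apply, v, dif_pos (hi.trans_le hdm), dif_pos (hj.trans_le hdm),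
      inner_smul_left, inner_smul_right, hw, Fin.mk.injEq, Fin.val_inj, Subtype.mk.injEq, if_pos hi]
    split_ifs
    · have := Real.mul_self_sqrt hc'.le
      have := (Real.sqrt_pos.2 hc').ne'
      simp only [conj_trivial]
      field_simp
      linarith
    · simp
  obtain ⟨b, hb⟩ := hv.exists_orthonormalBasis_extension_of_card_eq (by simp)
  have hbw : ∀ i r, inner ℝ (b i) (w r) =
      if (r : ℕ) < d ∧ (i : ℕ) = r then Real.sqrt c else 0 := by
    intro i r
    by_cases hr : (r : ℕ) < d
    · have hc' := (Real.sqrt_pos.2 (hc (by omega))).ne'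
      have h1 : w r = Real.sqrt c • b ⟨r, hr.trans_le hdk⟩ := by
        rw [hb ⟨r, hr.trans_le hdk⟩ hr]
        simp [v, smul_smul, mul_inv_cancel₀ hc']
      rw [h1, inner_smul_right, orthonormal_iff_ite.1 b.orthonormal]
      simp [Fin.ext_iff, hr]
    · have h1 : w r = 0 := by
        rw [← inner_self_eq_zero (𝕜 := ℝ), hw, if_pos rfl, if_neg hr]
      simp [h1, hr]
  -- The rotation respects the splitting k + 1, so the block shape Q(k,1) survives the change of
  -- frame.
  let P : Matrix (Fin k ⊕ Fin 1) (Fin k ⊕ Fin 1) ℝ :=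
    fromBlocks (Matrix.of fun j i => b i j) 0 0 1
  have hP : Pᵀ * P = 1 := by
    have h1 : (Matrix.of fun j i => b i j)ᵀ * (Matrix.of fun j i => b i j) = 1 := by
      ext i j
      have h2 := orthonormal_iff_ite.1 b.orthonormal i j
      rw [hin] at h2
      rw [Matrix.mul_apply, Matrix.one_apply, ← h2]
      rfl
    simp only [P, fromBlocks_transpose, fromBlocks_multiply, h1]
    simp
  have he'' := IsOrthonormalFor.of_orthogonal (B := metricForm g p) he hP
  obtain ⟨e', he'⟩ := he''.exists_basis (Module.finrank_eq_card_basis e).symm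
  have hinl : ∀ i, e' (Sum.inl i) = ∑ j, b i j • e (Sum.inl j) := fun i => by
    rw [he']
    simp [P]
  have hinr : e' (Sum.inr 0) = e (Sum.inr 0) := by
    rw [he']
    simp [P]
  obtain ⟨L, hL⟩ := hf.exists_secondFund_eq p
  refine ⟨e', ξ, he' ▸ he'', hξ ▸ hξ', fun r => ?_⟩
  obtain ⟨q1, q2, q3⟩ := matrixOf_mem_austereQ_iff.1 (hq (ξ r))
  have key : ∀ i, ∑ j, b i j * secondFund h f p (ξ r) (e (Sum.inl j)) (e (Sum.inr 0)) =
      if (r : ℕ) < d ∧ (i : ℕ) = r then Real.sqrt c else 0 := fun i => by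
    rw [← hbw, hin]
  refine ⟨fun i j => ?_, ?_, fun i => ⟨?_, ?_⟩⟩
  · simp only [hL] at q1
    simp [hinl, hL, q1]
  · rw [hinr, q3]
  · rw [← key, hinl, hinr]
    simp [hL]
  · rw [← key, hinl, hinr]
    simp only [← q2]
    simp [hL]

end IsIsometricImmersion

end Submanifold

theorem IsOrthonormalFor.reindex {V ι ι' : Type*} [AddCommGroup V] [Module ℝ V] {B : V → V → ℝ}
    {e : Module.Basis ι ℝ V} (he : IsOrthonormalFor B e) (σ : ι ≃ ι') :
    IsOrthonormalFor B (e.reindex σ) := by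
  refine ⟨fun i => ?_, fun i j hij => ?_⟩
  · rw [Module.Basis.reindex_apply]
    exact he.1 _
  · rw [Module.Basis.reindex_apply, Module.Basis.reindex_apply]
    exact he.2 _ _ fun h => hij (σ.symm.injective h)

/-- The entries of the standard matrices of the equality case, in block form. -/
theorem smul_matUnit_add_apply (k r : ℕ) (hr : r < k) (c : ℝ) (a b : Fin k ⊕ Fin 1) :
    (c • (matUnit (k + 1) r (k + 1 - 1) + matUnit (k + 1) (k + 1 - 1) r)) (finSumFinEquiv a)
      (finSumFinEquiv b) =
      Matrix.fromBlocks 0 (Matrix.of fun (i : Fin k) (_ : Fin 1) => if (i : ℕ) = r then c else 0)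
        (Matrix.of fun (_ : Fin 1) (i : Fin k) => if (i : ℕ) = r then c else 0) 0 a b := by
  rcases a with a | a <;> rcases b with b | b
  · have := a.2.ne
    have := b.2.ne
    simp [matUnit, *]
  · have := a.2.ne
    simp [matUnit, *]
  · have := b.2.ne
    simp [matUnit, *]
  · simp [matUnit, hr.ne']

/-! ### The pointwise inequality and the standard form. -/

section Submanifold

variable {k m : ℕ} {M N : Type*} [TopologicalSpace M]
  [ChartedSpace (EuclideanSpace ℝ (Fin (k + 1))) M]
  [IsManifold (𝓡 (k + 1)) ∞ M] [TopologicalSpace N]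
  [ChartedSpace (EuclideanSpace ℝ (Fin (k + 1 + m))) N]
  [IsManifold (𝓡 (k + 1 + m)) ∞ N] {g : SmoothMetric (k + 1) M}
  {h : SmoothMetric (k + 1 + m) N} {f : M → N}
  {κ : ℝ} {p : M} {e : Module.Basis (Fin k ⊕ Fin 1) ℝ (TangentSpace (𝓡 (k + 1)) p)}

theorem trace_matrixOf {V ι : Type*} [Fintype ι] (B : V → V → ℝ) (e : ι → V) :
    (matrixOf B e).trace = ∑ i, B (e i) (e i) := rfl

theorem trace_gramForm_mul_self {ι : Type*} [Fintype ι]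
    (e : Fin k ⊕ Fin 1 → TangentSpace (𝓡 (k + 1)) p) (ξ : ι → normalSpace (n := k + 1) h f p) :
    (matrixOf (gramForm h f p e) ξ * matrixOf (gramForm h f p e) ξ).trace =
      ∑ r, ∑ s, gramForm h f p e (ξ r) (ξ s) ^ 2 := by
  simp only [Matrix.trace, Matrix.diag, Matrix.mul_apply, matrixOf, Matrix.of_apply]
  refine Finset.sum_congr rfl fun r _ => Finset.sum_congr rfl fun s _ => ?_
  rw [sq]
  congr 1
  exact Finset.sum_congr rfl fun i _ => mul_comm _ _

namespace IsIsometricImmersion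

open Matrix

/-- In the frames of the equality case, the Gram matrix is a multiple of a projection. -/
theorem sq_sum_gramForm_eq (hf : IsIsometricImmersion g h f)
    {d : ℕ} (hdk : d ≤ k) (hdm : d ≤ m)
    (e : Module.Basis (Fin (k + 1)) ℝ (TangentSpace (𝓡 (k + 1)) p))
    (ξ : Module.Basis (Fin m) ℝ (normalSpace (n := k + 1) h f p)) (c : ℝ)
    (hA : ∀ r : Fin m, matrixOf (secondFund h f p (ξ r)) e =
      if (r : ℕ) < d then
        c • (matUnit (k + 1) r (k + 1 - 1) + matUnit (k + 1) (k + 1 - 1) r) else 0) :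
    (∀ η, matrixOf (secondFund h f p η) (e.reindex finSumFinEquiv.symm) ∈ austereQ k 1) ∧
    (∑ r, gramForm h f p (e.reindex finSumFinEquiv.symm) (ξ r) (ξ r)) ^ 2 =
      d * ∑ r, ∑ s, gramForm h f p (e.reindex finSumFinEquiv.symm) (ξ r) (ξ s) ^ 2 := by
  obtain ⟨L, hL⟩ := hf.exists_secondFund_eq p
  have hent : ∀ r a b, secondFund h f p (ξ r) (e.reindex finSumFinEquiv.symm a)
      (e.reindex finSumFinEquiv.symm b) = if (r : ℕ) < d then
      Matrix.fromBlocks 0 (Matrix.of fun (i : Fin k) (_ : Fin 1) => if (i : ℕ) = r then c else 0)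
        (Matrix.of fun (_ : Fin 1) (i : Fin k) => if (i : ℕ) = r then c else 0) 0 a b else 0 := by
    intro r a b
    have h1 := congrFun (congrFun (hA r) (finSumFinEquiv a)) (finSumFinEquiv b)
    rw [Module.Basis.reindex_apply, Module.Basis.reindex_apply, Equiv.symm_symm]
    refine h1.trans ?_
    split_ifs with hr
    · exact smul_matUnit_add_apply k r (hr.trans_le hdk) c a b
    · rfl
  generalize e.reindex finSumFinEquiv.symm = e' at hent ⊢
  constructor
  · intro η
    -- Since Q(k,1) is a subspace, it is enough to check the frame vectors.
    have hη : matrixOf (secondFund h f p η) e' =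
        ∑ r, ξ.repr η r • matrixOf (secondFund h f p (ξ r)) e' := by
      ext a b
      rw [Matrix.sum_apply]
      simp only [matrixOf, Matrix.of_apply, Matrix.smul_apply, hL]
      have h1 := congrArg (fun ζ => L ζ (e' a) (e' b)) (ξ.sum_repr η)
      simpa only [map_sum, map_smul, LinearMap.sum_apply, LinearMap.smul_apply] using h1.symm
    rw [hη]
    refine Submodule.sum_mem _ fun r _ => Submodule.smul_mem _ _ ?_
    rw [matrixOf_mem_austereQ_iff]
    simp [hent]
  -- The Gram matrix is c² times the projection to the first `d` coordinates, so T = d c² and S = d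
  -- c⁴. The bound `hdk` keeps position r inside the off-diagonal block, and `hdm` makes the number
  -- of such r equal to d.
  · have hβ : ∀ r s, gramForm h f p e' (ξ r) (ξ s) =
        if r = s then (if (r : ℕ) < d then c ^ 2 else 0) else 0 := by
      intro r s
      simp only [gramForm, hent, fromBlocks_apply₁₂, Matrix.of_apply]
      by_cases hr : (r : ℕ) < d
      · rw [Finset.sum_eq_single (⟨r, hr.trans_le hdk⟩ : Fin k)]
        · by_cases hrs : r = s
          · subst hrs
            simp [hr, sq]
          · have hne : (r : ℕ) ≠ s := fun h0 => hrs (Fin.ext h0)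
            simp [hrs, hne]
        · intro b _ hb
          have : (b : ℕ) ≠ r := fun h0 => hb (Fin.ext h0)
          simp [this]
        · simp
      · simp [hr]
    have hcard : ∀ t : ℝ, ∑ r : Fin m, (if (r : ℕ) < d then t else 0) = d * t := by
      intro t
      rw [← Finset.sum_filter, Finset.sum_const, Fin.card_filter_val_lt, min_eq_right hdm,
        nsmul_eq_mul]
    simp only [hβ, if_true, ite_pow, ne_eq, OfNat.ofNat_ne_zero, not_false_eq_true, zero_pow,
      Finset.sum_ite_eq, Finset.mem_univ, hcard]
    ring

/-- The normal scalar curvature inequality at a point, and its equality case. -/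
theorem normNormalScalarCurv_le (hf : IsIsometricImmersion g h f) (hk : 1 ≤ k)
    (hN : HasConstantCurvature h κ)
    (he : IsOrthonormalFor (fun u v => g.inner p u v) e)
    (hq : ∀ ξ, matrixOf (secondFund h f p ξ) e ∈ austereQ k 1) {d : ℕ}
    (hd : d = Module.finrank ℝ (secondFundSpan (n := k + 1) h f p))
    {ξ : Module.Basis (Fin m) ℝ (normalSpace (n := k + 1) h f p)}
    (hξ : IsOrthonormalFor (fun v w => h.inner (f p) v.1 w.1) ξ) :
    normNormalScalarCurv g h f p ≤
        Real.sqrt (((d : ℝ) - 1) / (2 * d)) * (κ - normScalarCurv g p) ∧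
      (normNormalScalarCurv g h f p =
          Real.sqrt (((d : ℝ) - 1) / (2 * d)) * (κ - normScalarCurv g p) ↔
        (∑ r, gramForm h f p e (ξ r) (ξ r)) ^ 2 =
          d * ∑ r, ∑ s, gramForm h f p e (ξ r) (ξ s) ^ 2) := by
  obtain ⟨hpsd, hrank, -⟩ := hf.posSemidef_gramForm hq ξ
  obtain ⟨h1, h2⟩ := hf.normNormalScalarCurv_eq hN he hq hξ
  rw [h1, hf.sub_normScalarCurv_eq hN hk he hq hξ]
  have h3 := sq_trace_le_rank_mul hpsd
  rw [hrank, ← hd, trace_matrixOf, trace_gramForm_mul_self] at h3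
  set T := ∑ r, gramForm h f p e (ξ r) (ξ r) with hTdef
  set S := ∑ r, ∑ s, gramForm h f p e (ξ r) (ξ s) ^ 2 with hSdef
  have hT0 : 0 ≤ T := Finset.sum_nonneg fun r _ => Finset.sum_nonneg fun i _ => mul_self_nonneg _
  have hS0 : 0 ≤ S := Finset.sum_nonneg fun r _ => Finset.sum_nonneg fun i _ => sq_nonneg _
  have hk' : (1 : ℝ) ≤ k := by exact_mod_cast hk
  -- Positivity of the common normalising factor, from n ≥ 2, lets it be cancelled in the equality
  -- case as well.
  have hC : 0 < 2 / (((k + 1 : ℕ) : ℝ) * (((k + 1 : ℕ) : ℝ) - 1)) := by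
    push_cast
    have : (0 : ℝ) < (k + 1) * (k + 1 - 1) := mul_pos (by linarith) (by linarith)
    positivity
  obtain ⟨h4, h5⟩ := sqrt_half_le_and_eq_iff d hT0 hS0 h2 h3
  rw [mul_left_comm]
  refine ⟨mul_le_mul_of_nonneg_left h4 hC.le, ?_⟩
  rw [mul_right_inj' hC.ne']
  exact h5

end IsIsometricImmersion

end Submanifold

end AustereSubmanifold

theorem mainTheorem5 (n m : ℕ) (hn : 2 ≤ n) (κ : ℝ)
    {M N : Type*}
    [TopologicalSpace M] [ChartedSpace (EuclideanSpace ℝ (Fin n)) M] [IsManifold (𝓡 n) ∞ M]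
    [TopologicalSpace N] [ChartedSpace (EuclideanSpace ℝ (Fin (n + m))) N]
    [IsManifold (𝓡 (n + m)) ∞ N]
    (g : AustereSubmanifold.SmoothMetric n M) (h : AustereSubmanifold.SmoothMetric (n + m) N)
    (hN : AustereSubmanifold.HasConstantCurvature h κ)
    (f : M → N) (hf : AustereSubmanifold.IsIsometricImmersion g h f)
    (hA : AustereSubmanifold.IsAustere g h f)
    (hQ : AustereSubmanifold.IsOfType (AustereSubmanifold.austereQ (n - 1) 1) g h f)
    (p : M) (d : ℕ)
    (hd : d = Module.finrank ℝ (AustereSubmanifold.secondFundSpan (n := n) h f p)) :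
    AustereSubmanifold.normNormalScalarCurv g h f p ≤
        Real.sqrt (((d : ℝ) - 1) / (2 * d)) * (κ - AustereSubmanifold.normScalarCurv g p) ∧
      (AustereSubmanifold.normNormalScalarCurv g h f p =
          Real.sqrt (((d : ℝ) - 1) / (2 * d)) * (κ - AustereSubmanifold.normScalarCurv g p) ↔
        ∃ (e : Module.Basis (Fin n) ℝ (TangentSpace (𝓡 n) p))
          (ξ : Module.Basis (Fin m) ℝ (AustereSubmanifold.normalSpace (n := n) h f p)) (c : ℝ),
          AustereSubmanifold.IsOrthonormalFor (fun u v => g.inner p u v) e ∧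
          AustereSubmanifold.IsOrthonormalFor (fun v w => h.inner (f p) v.1 w.1) ξ ∧
          ∀ r : Fin m,
            AustereSubmanifold.matrixOf (AustereSubmanifold.secondFund h f p (ξ r)) e =
              if (r : ℕ) < d then
                c • (AustereSubmanifold.matUnit n r (n - 1) +
                  AustereSubmanifold.matUnit n (n - 1) r)
              else 0) := by

  obtain ⟨k, rfl⟩ : ∃ k, n = k + 1 := ⟨n - 1, by omega⟩
  obtain ⟨e, he, hBe⟩ := hQ p
  -- After the substitution the block size is k + 1 - 1, which is k by definition.
  change Module.Basis (Fin k ⊕ Fin 1) ℝ (TangentSpace (𝓡 (k + 1)) p) at e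
  have hq : ∀ ξ, AustereSubmanifold.matrixOf (AustereSubmanifold.secondFund h f p ξ) e ∈
      AustereSubmanifold.austereQ k 1 := fun ξ => hBe _ (Submodule.subset_span ⟨ξ, rfl⟩)
  have hfin := hf.finrank_normalSpace_add p
  have hm : Module.finrank ℝ (AustereSubmanifold.normalSpace (n := k + 1) h f p) = m := by omega
  obtain ⟨ξ₀, hξ₀⟩ : ∃ ξ : Module.Basis (Fin m) ℝ
      (AustereSubmanifold.normalSpace (n := k + 1) h f p),
      AustereSubmanifold.IsOrthonormalFor (fun v w => h.inner (f p) v.1 w.1) ξ :=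
    ⟨(AustereSubmanifold.normalFrame h f p).reindex (finCongr hm),
      (AustereSubmanifold.normalFrame_orthonormal h f p).reindex _⟩
  obtain ⟨hpsd, hrank, hrk⟩ := hf.posSemidef_gramForm hq ξ₀
  rw [← hd] at hrank
  have hdk : d ≤ k := hrank ▸ hrk
  have hdm : d ≤ m := by
    have := Matrix.rank_le_card_width
      (AustereSubmanifold.matrixOf (AustereSubmanifold.gramForm h f p e) ξ₀)
    rwa [hrank, Fintype.card_fin] at this
  obtain ⟨h1, h2⟩ := hf.normNormalScalarCurv_le (by omega) hN he hq hd hξ₀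
  refine ⟨h1, fun heq => ?_, ?_⟩
  · have h3 := h2.1 heq
    rw [← AustereSubmanifold.trace_gramForm_mul_self, ← AustereSubmanifold.trace_matrixOf,
      ← hrank] at h3
    obtain ⟨U, c, hU, -, hc, hdiag⟩ :=
      AustereSubmanifold.exists_diagonalization_of_sq_trace_eq hpsd h3
    rw [hrank] at hc hdiag
    obtain ⟨e', ξ, he', hξ, hII⟩ := hf.exists_frames he hq hξ₀ hU hc hdm hdk hdiag
    -- The scalar λ is √c, the common length of the nonzero vectors a_r. The reindexing puts the
    -- distinguished tangent vector last.
    refine ⟨e'.reindex finSumFinEquiv, ξ, Real.sqrt c, he'.reindex _, hξ, fun r => ?_⟩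
    obtain ⟨q1, q2, q3⟩ := hII r
    ext a b
    obtain ⟨a, rfl⟩ := finSumFinEquiv.surjective a
    obtain ⟨b, rfl⟩ := finSumFinEquiv.surjective b
    have hent : AustereSubmanifold.matrixOf (AustereSubmanifold.secondFund h f p (ξ r))
        (e'.reindex finSumFinEquiv) (finSumFinEquiv a) (finSumFinEquiv b) =
        AustereSubmanifold.secondFund h f p (ξ r) (e' a) (e' b) := by
      rw [AustereSubmanifold.matrixOf, Matrix.of_apply, Module.Basis.reindex_apply,
        Module.Basis.reindex_apply, Equiv.symm_apply_apply, Equiv.symm_apply_apply]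
    rw [hent]
    by_cases hr : (r : ℕ) < d
    · rw [if_pos hr, AustereSubmanifold.smul_matUnit_add_apply k r (hr.trans_le hdk)]
      rcases a with a | a <;> rcases b with b | b
      · simp [q1]
      · obtain rfl := Subsingleton.elim b 0
        simp [(q3 a).1, hr]
      · obtain rfl := Subsingleton.elim a 0
        simp [(q3 b).2, hr]
      · obtain rfl := Subsingleton.elim a 0
        obtain rfl := Subsingleton.elim b 0
        simp [q2]
    · rw [if_neg hr]
      rcases a with a | a <;> rcases b with b | b
      · simp [q1]
      · obtain rfl := Subsingleton.elim b 0
        simp [(q3 a).1, hr]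
      · obtain rfl := Subsingleton.elim a 0
        simp [(q3 b).2, hr]
      · obtain rfl := Subsingleton.elim a 0
        obtain rfl := Subsingleton.elim b 0
        simp [q2]
  · rintro ⟨e', ξ, c, he', hξ, hA'⟩
    obtain ⟨hq', h3⟩ := hf.sq_sum_gramForm_eq hdk hdm e' ξ c hA'
    -- The frame of the standard form need not be the one supplied by `hQ`. It is itself adapted to
    -- Q(k,1), so the pointwise equality criterion is used with its own Gram matrix.
    exact (hf.normNormalScalarCurv_le (by omega) hN (he'.reindex _) hq' hd hξ).2.2 h3
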